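/- **Stable models and $\mathrm{LP}^{\mathrm{MLN}}$.** Interpretations are sets of atoms of a finite propositional signature. The reduct $F^I$ of a formula $F$ is obtained by replacing every maximal subformula of $F$ not satisfied by $I$ with $\bot$; $I$ is a *stable model* of a set $\Gamma$ of formulas if it is a minimal model of $\{F^I : F\in\Gamma\}$. A rule $H\leftarrow B$ is the formula $B\to H$, and "not" is $\neg$. An aggregate atom $y=\#\mathrm{sum}\{p_1:F_1;\dots;p_n:F_n\}$ stands for $\bigwedge_{X\subseteq\{1,\dots,n\},\ \sum_{i\in X}p_i\ne y}\bigl(\bigwedge_{i\in X}F_i\to\bigvee_{i\notin X}F_i\bigr)$, and $\#\mathrm{count}$ is $\#\mathrm{sum}$ with all weights $1$. A (ground) $\mathrm{LP}^{\mathrm{MLN}}$ program $Q$ is a finite set of weighted formulas $w:F$ with $w\in\mathbb R$ (soft) or $w=\alpha$ (hard). Let $Q_I=\{w:F\in Q\mid I\models F\}$, and let $\mathrm{SM}[Q]$ be the set of all $I$ that are stable models of the formulas in $Q_I$. Put $W_Q(I)=\exp\bigl(\sum_{w:F\in Q_I}w\bigr)$ if $I\in\mathrm{SM}[Q]$ and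 $W_Q(I)=0$ otherwise, and $P_Q(I)=\lim_{\alpha\to\infty}W_Q(I)/\sum_{J\in\mathrm{SM}[Q]}W_Q(J)$. A *probabilistic stable model* of $Q$ is an interpretation $I$ with $P_Q(I)\neq0$. **P-log.** A sorted signature $\sigma_1$ consists of finitely many constants $c:s_1\times\dots\times s_n\to s_0=\mathit{Range}(c)$ over finite sorts; its atoms are $c(\vec u)=v$ with $\vec u\in s_1\times\dots\times s_n$ and $v\in\mathit{Range}(c)$, and the symbols $c(\vec u)$ are its attributes. A literal is an atom $A$ or $\mathit{not}\,A$. A P-log program $\Pi=\langle \mathbf R,\mathbf S,\mathbf P,\mathbf{Obs},\mathbf{Act}\rangle$ consists of: a finite set $\mathbf R$ of normal rules over $\sigma_1$; a finite set $\mathbf S$ of random selection rules $[r]\ random(c(\vec u):\{x:p(x)\})\leftarrow Body$, with unique identifiers $r$, unary Boolean constants $p$ and finite sets $Body$ of literals (or $random(c(\vec u))\leftarrow Body$ without $p$, in which case $p(v)$ is read as true below; $p(v)$ is false if $v$ is not in the argument sort of $p$); a finite set $\mathbf P$ of pr-atoms $pr_r(c(\vec u)=v\mid C)=q$, where $r$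 is a rule for $c(\vec u)$ in $\mathbf S$, $C$ is a finite set of literals and $q\in[0,1]$; and finite sets $\mathbf{Obs}$ of facts $Obs(c(\vec u)=v)$, $Obs(c(\vec u)\ne v)$ and $\mathbf{Act}$ of facts $Do(c(\vec u)=v)$. Its answer set program $\tau(\Pi)$ over the signature $\sigma$ (the atoms of $\sigma_1$, the atoms $Obs(\cdot)$ and $Do(\cdot)$, and $\mathit{Intervene}(c(\vec u))$) contains: * the rules in $\mathbf R$, and $\leftarrow c(\vec u)=v_1,\ c(\vec u)=v_2$ for all attributes and all values $v_1\ne v_2$; * for each rule $r$ in $\mathbf S$, $\ c(\vec u)=v_1;\dots;c(\vec u)=v_n\leftarrow Body,\mathit{not}\ \mathit{Intervene}(c(\vec u))$, where $\mathit{Range}(c)=\{v_1,\dots,v_n\}$, and $\leftarrow c(\vec u)=v,\mathit{not}\ p(v),Body,\mathit{not}\ \mathit{Intervene}(c(\vec u))$ for all $v\in\mathit{Range}(c)$; * the facts in $\mathbf{Obs}$, with $\leftarrow Obs(c(\vec u)=v),\mathit{not}\ c(\vec u)=v$, resp. $\leftarrow Obs(c(\vec u)\ne v),c(\vec u)=v$;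 * the facts in $\mathbf{Act}$, with $c(\vec u)=v\leftarrow Do(c(\vec u)=v)$ and $\mathit{Intervene}(c(\vec u))\leftarrow Do(c(\vec u)=v)$. The *possible worlds* of $\Pi$ are the stable models $W$ of $\tau(\Pi)$. An atom $c(\vec u)=v$ is *possible in $W$ due to* a rule $r$ for $c(\vec u)$ in $\mathbf S$ if $W\models Body\wedge p(v)\wedge\neg\mathit{Intervene}(c(\vec u))$, and *possible in $W$* if this is so for some $r$. A pr-atom $pr_r(c(\vec u)=v\mid C)=q$ is *applied in $W$* if $c(\vec u)=v$ is possible in $W$ due to $r$ and $W\models C$. All P-log programs are assumed to satisfy: (1) no possible world satisfies the bodies of two different random selection rules for the same attribute; (2) for two different pr-atoms $pr_r(c(\vec u)=v\mid C_1)=q_1$ and $pr_r(c(\vec u)=v\mid C_2)=q_2$, no possible world satisfies the body of $r$, $C_1$ and $C_2$ together. Let $AV_W(c(\vec u))$ be the set of the values $v$ for which some pr-atom $pr_r(c(\vec u)=v\mid C)=q$ is applied in $W$; its number $q$ is then unique and denoted by $q_W(c(\vec u)=v)$. For an atom $c(\vec u)=v$ possible in $W$, let $P(W,c(\vec u)=v)=q_W(c(\vec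 u)=v)$ if $v\in AV_W(c(\vec u))$, and otherwise $$P(W,c(\vec u)=v)=\max\left(\frac{1-\sum_{v'\in AV_W(c(\vec u))}q_W(c(\vec u)=v')}{|\{v''\mid c(\vec u)=v''\text{ is possible in }W\text{ and }v''\notin AV_W(c(\vec u))\}|},\,0\right).$$ Let $\hat\mu_\Pi(W)$ be the product of $P(W,A)$ over all atoms $A\in W$ of $\sigma_1$ that are possible in $W$, and $\mu_\Pi(W)=\hat\mu_\Pi(W)/\sum_{W'}\hat\mu_\Pi(W')$, where the sum is over all possible worlds. $\Pi$ is *consistent* if some possible world has nonzero probability. **The translation.** $\mathrm{plog2lpmln}(\Pi)$ consists of $\alpha:R$ for every rule $R$ of $\tau(\Pi)$, and of the following rules over additional auxiliary atoms. * For each random selection rule $r$ as above and each $v\in\mathit{Range}(c)$: $\ \alpha:\ Poss_r(c(\vec u)=v)\leftarrow Body,p(v),\mathit{not}\ \mathit{Intervene}(c(\vec u))$. * For each pr-atom $pr_r(c(\vec u)=v\mid C)=q$: $\alpha:\ PossWithAssPr_{r,C}(c(\vec u)=v)\leftarrow Poss_r(c(\vec u)=v),C$; $\alpha:\ AssPr_{r,C}(c(\vec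 u)=v)\leftarrow c(\vec u)=v,PossWithAssPr_{r,C}(c(\vec u)=v)$; $\ln q:\ \bot\leftarrow\mathit{not}\ AssPr_{r,C}(c(\vec u)=v)$ if $q>0$, and $\alpha:\ \bot\leftarrow AssPr_{r,C}(c(\vec u)=v)$ if $q=0$; $\alpha:\ PossWithAssPr(c(\vec u)=v)\leftarrow PossWithAssPr_{r,C}(c(\vec u)=v)$. * For each random selection rule $r$ for $c(\vec u)$, each $v\in\mathit{Range}(c)$ and $m\in\{1,\dots,|\mathit{Range}(c)|\}$: $\alpha:\ PossWithDefPr(c(\vec u)=v)\leftarrow Poss_r(c(\vec u)=v),\mathit{not}\ PossWithAssPr(c(\vec u)=v)$; $\alpha:\ NumDefPr(c(\vec u),m)\leftarrow c(\vec u)=v,\ PossWithDefPr(c(\vec u)=v),\ m=\#\mathrm{count}\{y:PossWithDefPr(c(\vec u)=y)\}$; $\ln\frac1m:\ \bot\leftarrow\mathit{not}\ NumDefPr(c(\vec u),m)$ if $m\ge2$. * For each random selection rule $r$ for $c(\vec u)$ with associated pr-atoms $pr_r(c(\vec u)=v_i\mid C_i)=q_i$ ($i=1,\dots,n$, $n\ge1$),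 each $v\in\mathit{Range}(c)$, and each number $x$ of the form $1$ minus the sum of the probabilities in a set of pr-atoms of $\Pi$ for $c(\vec u)$: $\alpha:\ RemPr(c(\vec u),x)\leftarrow Body,\ c(\vec u)=v,\ PossWithDefPr(c(\vec u)=v),\ 1-x=\#\mathrm{sum}\{q_1:PossWithAssPr_{r,C_1}(c(\vec u)=v_1);\dots;q_n:PossWithAssPr_{r,C_n}(c(\vec u)=v_n)\}$; if $x>0$, $\ \alpha:\ TotalDefPr(c(\vec u),x)\leftarrow RemPr(c(\vec u),x)$ and $\ln x:\ \bot\leftarrow\mathit{not}\ TotalDefPr(c(\vec u),x)$; if $x\le0$, $\ \alpha:\ \bot\leftarrow RemPr(c(\vec u),x)$. **Theorem.** Let $\Pi$ be a consistent P-log program. The limits $P_{\mathrm{plog2lpmln}(\Pi)}(I)$ exist for all interpretations $I$, and there is a 1-1 correspondence $\phi$ between the possible worlds of $\Pi$ with nonzero probability and the probabilistic stable models of $\mathrm{plog2lpmln}(\Pi)$ such that * for every possible world $W$ of $\Pi$ with nonzero probability, $\phi(W)$ is a probabilistic stable model of $\mathrm{plog2lpmln}(\Pi)$ and $\mu_\Pi(W)=P_{\mathrm{plog2lpmln}(\Pi)}(\phi(W))$;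 * for every probabilistic stable model $I$ of $\mathrm{plog2lpmln}(\Pi)$, the restriction $I|_\sigma$ to the signature of $\tau(\Pi)$ is a possible world of $\Pi$, $I=\phi(I|_\sigma)$, and $\mu_\Pi(I|_\sigma)>0$. -/

import Mathlib

universe u v w

namespace PLogMLN

noncomputable section

open scoped Classical

/-! ### Propositional formulas and stable models -/

/-- Propositional formulas over the atoms `α`. A rule `Head ← Body` is the formula `Body → Head`. -/
inductive Formula (α : Type u) : Type u
  | bot : Formula α
  | atom (a : α) : Formula α
  | and (F G : Formula α) : Formula α
  | or (F G : Formula α) : Formula α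
  | imp (F G : Formula α) : Formula α

namespace Formula

variable {α : Type u} {β : Type v} {ι : Type w}

/-- Negation (as failure) `not F`. -/
def neg (F : Formula α) : Formula α := imp F bot

def top : Formula α := imp bot bot

/-- Conjunction of finitely many formulas. -/
def conj (s : Finset ι) (f : ι → Formula α) : Formula α :=
  s.toList.foldr (fun i G => and (f i) G) top

/-- Disjunction of finitely many formulas. -/
def disj (s : Finset ι) (f : ι → Formula α) : Formula α :=
  s.toList.foldr (fun i G => or (f i) G) bot

/-- Renaming of atoms. -/
def map (g : α → β) : Formula α → Formula β
  | bot => bot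
  | atom a => atom (g a)
  | and F G => and (map g F) (map g G)
  | or F G => or (map g F) (map g G)
  | imp F G => imp (map g F) (map g G)

/-- `I ⊨ F`; an interpretation is the set of the atoms that it makes true. -/
def Sat (I : Set α) : Formula α → Prop
  | bot => False
  | atom a => a ∈ I
  | and F G => Sat I F ∧ Sat I G
  | or F G => Sat I F ∨ Sat I G
  | imp F G => Sat I F → Sat I G

/-- The reduct `F^I`: every maximal subformula of `F` that `I` does not satisfy becomes `⊥`. -/
def reduct (I : Set α) : Formula α → Formula α
  | bot => bot
  | atom a => if a ∈ I then atom a else bot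
  | and F G => if Sat I (and F G) then and (reduct I F) (reduct I G) else bot
  | or F G => if Sat I (or F G) then or (reduct I F) (reduct I G) else bot
  | imp F G => if Sat I (imp F G) then imp (reduct I F) (reduct I G) else bot

/-- The aggregate atom `y = #sum { p i : F i | i ∈ ι }` (each `i` with `F i` true contributes `p i`)
as a propositional formula under the stable model semantics: for every set `X` of indices whose
weights do not sum up to `y`, if all `F i` with `i ∈ X` hold, then so does some `F i`
with `i ∉ X`. -/
def sumEq [Finite ι] (F : ι → Formula α) (p : ι → ℝ) (y : ℝ) : Formula α :=
  conj (Set.toFinite {X : Finset ι | ∑ i ∈ X, p i ≠ y}).toFinset fun X =>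
    imp (conj X F) (disj (Set.toFinite {i : ι | i ∉ X}).toFinset F)

/-- The aggregate atom `m = #count { i : F i }`. -/
def countEq [Finite ι] (F : ι → Formula α) (m : ℕ) : Formula α :=
  sumEq F (fun _ => 1) (m : ℝ)

end Formula

/-- `I` is a stable model of `Γ`: it is a minimal model of the reduct of `Γ` relative to `I`. -/
def IsStableModel {α : Type u} (Γ : Set (Formula α)) (I : Set α) : Prop :=
  (∀ F ∈ Γ, (F.reduct I).Sat I) ∧ ∀ J : Set α, J ⊆ I → (∀ F ∈ Γ, (F.reduct I).Sat J) → J = I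

/-! ### LP^MLN -/

/-- Weights: `hard` is the infinite weight `α`. -/
inductive Weight : Type
  | hard : Weight
  | soft (x : ℝ) : Weight

/-- The value of a weight, when a real number `a` is put in place of the symbol `α`. -/
def Weight.val (a : ℝ) : Weight → ℝ
  | hard => a
  | soft x => x

/-- A (ground) LP^MLN program: a finite set of weighted formulas. -/
abbrev LPMLN (α : Type u) := Finset (Weight × Formula α)

namespace LPMLN

variable {α : Type u}

/-- The weighted formulas of the program that `I` satisfies. -/
def satisfied (Q : LPMLN α) (I : Set α) : LPMLN α := Q.filter fun x => x.2.Sat I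

/-- `SM[Q]`: the interpretations `I` that are stable models of the formulas of `Q` satisfied
by `I`. -/
def SM (Q : LPMLN α) : Set (Set α) :=
  {I | IsStableModel {F | ∃ x ∈ Q.satisfied I, x.2 = F} I}

/-- The unnormalized weight of `I`, as a function of the value `a` of the symbol `α`. -/
def weight (Q : LPMLN α) (a : ℝ) (I : Set α) : ℝ :=
  if I ∈ Q.SM then Real.exp (∑ x ∈ Q.satisfied I, x.1.val a) else 0

/-- The normalized weight before the passage to the limit. -/
def ratio [Finite α] (Q : LPMLN α) (I : Set α) (a : ℝ) : ℝ :=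
  Q.weight a I / ∑ J ∈ (Set.toFinite Q.SM).toFinset, Q.weight a J

/-- The probability of `I` under `Q`. -/
def prob [Finite α] (Q : LPMLN α) (I : Set α) : ℝ :=
  Filter.limUnder Filter.atTop (Q.ratio I)

/-- Probabilistic stable models. -/
def IsProbStableModel [Finite α] (Q : LPMLN α) (I : Set α) : Prop := Q.prob I ≠ 0

end LPMLN

/-! ### Syntax of P-log -/

/-- The data of a sorted propositional signature: finitely many constants
`c : s₁ × ⋯ × sₙ → s₀`, where the sorts are finite sets of symbols. -/
structure Sig where
  Sym : Type u
  tt : Sym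
  ff : Sym
  tt_ne_ff : tt ≠ ff
  Const : Type v
  finite_const : Finite Const
  arity : Const → ℕ
  dom : (c : Const) → Fin (arity c) → Finset Sym
  range : Const → Finset Sym

namespace Sig

instance (S : Sig.{u, v}) : Finite S.Const := S.finite_const

/-- `c` is Boolean if its range is `{f, t}`. -/
def IsBoolean (S : Sig.{u, v}) (c : S.Const) : Prop :=
  ∀ x, x ∈ S.range c ↔ x = S.ff ∨ x = S.tt

/-- Attributes `c(u)`. -/
abbrev Attr (S : Sig.{u, v}) := Σ c : S.Const, ∀ i : Fin (S.arity c), {x : S.Sym // x ∈ S.dom c i}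

/-- The values `v ∈ Range(c)` of the attribute `c(u)`. -/
abbrev Range (S : Sig.{u, v}) (a : S.Attr) := {x : S.Sym // x ∈ S.range a.1}

/-- The atoms `c(u) = v` of the sorted signature. -/
abbrev Atom (S : Sig.{u, v}) := Σ a : S.Attr, S.Range a

/-- Literals: an atom `c(u) = v` or its negation `not c(u) = v`. -/
inductive Literal (S : Sig.{u, v}) : Type (max u v)
  | pos (A : S.Atom) : Literal S
  | neg (A : S.Atom) : Literal S

/-- Boolean constants with one argument. -/
abbrev UnaryBoolean (S : Sig.{u, v}) := {p : S.Const // S.arity p = 1 ∧ S.IsBoolean p}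

end Sig

/-- A normal rule `A ← B₁, …, Bₘ, not Bₘ₊₁, …, not Bₙ`. -/
structure NormalRule (S : Sig.{u, v}) where
  head : S.Atom
  body : Finset S.Literal

/-- A random selection rule `random(c(u) : {x : p(x)}) ← Body`; with `dyn = none` it is the rule
`random(c(u)) ← Body`, without a restriction of the range. -/
structure RandomRule (S : Sig.{u, v}) where
  attr : S.Attr
  dyn : Option S.UnaryBoolean
  body : Finset S.Literal

/-- A pr-atom `pr_r(c(u) = v | C) = p`, where `r` is the identifier of a random selection rule
for `c(u)`. -/
structure PrAtom {S : Sig.{u, v}} {Rid : Type w} (rule : Rid → RandomRule S) where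
  rid : Rid
  atom : S.Atom
  attr_eq : atom.1 = (rule rid).attr
  cond : Finset S.Literal
  prob : ℝ
  prob_nonneg : 0 ≤ prob
  prob_le_one : prob ≤ 1

/-- A P-log program `⟨R, S, P, Obs, Act⟩`. The random selection rules are indexed by their
identifiers; `obsEq`, `obsNe` and `act` hold the atoms `c(u) = v` for which
`Obs(c(u) = v)`, `Obs(c(u) ≠ v)` and `Do(c(u) = v)`, respectively, is a fact of the program. -/
structure PLog (S : Sig.{u, v}) where
  R : Finset (NormalRule S)
  Rid : Type w
  finite_rid : Finite Rid
  rule : Rid → RandomRule S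
  P : Finset (PrAtom rule)
  obsEq : Finset S.Atom
  obsNe : Finset S.Atom
  act : Finset S.Atom

/-- The atoms of `τ(L)`. -/
inductive BaseAtom (S : Sig.{u, v}) : Type (max u v)
  | val (A : S.Atom) : BaseAtom S
  | doEq (A : S.Atom) : BaseAtom S
  | obsEq (A : S.Atom) : BaseAtom S
  | obsNe (A : S.Atom) : BaseAtom S
  | intervene (a : S.Attr) : BaseAtom S

instance (S : Sig.{u, v}) : Finite (BaseAtom S) := by
  let f : S.Atom ⊕ S.Atom ⊕ S.Atom ⊕ S.Atom ⊕ S.Attr → BaseAtom S :=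
    Sum.elim .val (Sum.elim .doEq (Sum.elim .obsEq (Sum.elim .obsNe .intervene)))
  refine Finite.of_surjective f ?_
  rintro (A | A | A | A | a)
  · exact ⟨.inl A, rfl⟩
  · exact ⟨.inr (.inl A), rfl⟩
  · exact ⟨.inr (.inr (.inl A)), rfl⟩
  · exact ⟨.inr (.inr (.inr (.inl A))), rfl⟩
  · exact ⟨.inr (.inr (.inr (.inr a))), rfl⟩

/-- The finite set of the members of a finite family. -/
def family {ι : Type u} {β : Type v} [Finite ι] (f : ι → β) : Finset β :=
  (Set.finite_range f).toFinset

section Formulas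

variable {S : Sig.{u, v}}

/-- The formula `c(u) = v`. -/
def valF (A : S.Atom) : Formula (BaseAtom S) := .atom (.val A)

def interveneF (a : S.Attr) : Formula (BaseAtom S) := .atom (.intervene a)

def litF : S.Literal → Formula (BaseAtom S)
  | .pos A => valF A
  | .neg A => (valF A).neg

/-- A set of literals, read as the conjunction of its members. -/
def bodyF (B : Finset S.Literal) : Formula (BaseAtom S) := Formula.conj B litF

/-- The formula `p(x)`, that is, the atom `p(x) = t`; it is `⊥` if `x` is not in the argument sort
of `p`, and `⊤` if there is no `p`. -/
def dynF : Option S.UnaryBoolean → S.Sym → Formula (BaseAtom S)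
  | none, _ => .top
  | some p, x =>
    if h : ∀ i, x ∈ S.dom p.1 i then
      valF ⟨⟨p.1, fun i => ⟨x, h i⟩⟩, ⟨S.tt, (p.2.2 S.tt).2 (Or.inr rfl)⟩⟩
    else .bot

end Formulas

namespace PLog

variable {S : Sig.{u, v}}

instance (L : PLog.{u, v, w} S) : Finite L.Rid := L.finite_rid

/-- The attribute of the random selection rule `r`. -/
abbrev attr (L : PLog.{u, v, w} S) (r : L.Rid) : S.Attr := (L.rule r).attr

/-! ### The logical part `τ(L)` and the possible worlds -/

/-- The answer set program `τ(L)`. -/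
def tau (L : PLog.{u, v, w} S) : Finset (Formula (BaseAtom S)) :=
  -- the normal rules
  (family fun ρ : {ρ // ρ ∈ L.R} => (bodyF ρ.1.body).imp (valF ρ.1.head)) ∪
  -- `← c(u) = v₁, c(u) = v₂`, for different values `v₁` and `v₂`
  (family fun t : Σ a : S.Attr, {z : S.Range a × S.Range a // z.1 ≠ z.2} =>
    ((valF ⟨t.1, t.2.1.1⟩).and (valF ⟨t.1, t.2.1.2⟩)).imp .bot) ∪
  -- `c(u) = v₁; …; c(u) = vₙ ← Body, not Intervene(c(u))`
  (family fun r : L.Rid =>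
    ((bodyF (L.rule r).body).and (interveneF (L.attr r)).neg).imp
      (Formula.disj (Set.toFinite (Set.univ : Set (S.Range (L.attr r)))).toFinset
        fun v => valF ⟨L.attr r, v⟩)) ∪
  -- `← c(u) = v, not p(v), Body, not Intervene(c(u))`
  (family fun t : Σ r : L.Rid, S.Range (L.attr r) =>
    ((valF ⟨L.attr t.1, t.2⟩).and ((dynF (L.rule t.1).dyn t.2.1).neg.and
      ((bodyF (L.rule t.1).body).and (interveneF (L.attr t.1)).neg))).imp .bot) ∪
  -- `Obs(c(u) = v)` and `← Obs(c(u) = v), not c(u) = v`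
  (family fun A : {A // A ∈ L.obsEq} => .atom (.obsEq A.1)) ∪
  (family fun A : {A // A ∈ L.obsEq} =>
    ((Formula.atom (.obsEq A.1)).and (valF A.1).neg).imp .bot) ∪
  -- `Obs(c(u) ≠ v)` and `← Obs(c(u) ≠ v), c(u) = v`
  (family fun A : {A // A ∈ L.obsNe} => .atom (.obsNe A.1)) ∪
  (family fun A : {A // A ∈ L.obsNe} =>
    ((Formula.atom (.obsNe A.1)).and (valF A.1)).imp .bot) ∪
  -- `Do(c(u) = v)`, `c(u) = v ← Do(c(u) = v)` and `Intervene(c(u)) ← Do(c(u) = v)`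
  (family fun A : {A // A ∈ L.act} => .atom (.doEq A.1)) ∪
  (family fun A : {A // A ∈ L.act} => (Formula.atom (.doEq A.1)).imp (valF A.1)) ∪
  (family fun A : {A // A ∈ L.act} => (Formula.atom (.doEq A.1)).imp (interveneF A.1.1))

/-- The possible worlds `ω(L)`: the stable models of `τ(L)`. -/
def worlds (L : PLog.{u, v, w} S) : Set (Set (BaseAtom S)) :=
  {W | IsStableModel {F | F ∈ L.tau} W}

/-- Unique random selection rule: no possible world satisfies the bodies of two
random selection rules for the same attribute. -/
def UniqueRule (L : PLog.{u, v, w} S) : Prop :=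
  ∀ r₁ r₂ : L.Rid, r₁ ≠ r₂ → L.attr r₁ = L.attr r₂ →
    ∀ W ∈ L.worlds, ¬ ((bodyF (L.rule r₁).body).Sat W ∧ (bodyF (L.rule r₂).body).Sat W)

/-- Unique probability assignment: for two different pr-atoms
`pr_r(c(u) = v | C₁) = p₁` and `pr_r(c(u) = v | C₂) = p₂`, no possible world satisfies the body of
the rule `r`, `C₁` and `C₂` together. -/
def UniqueAssignment (L : PLog.{u, v, w} S) : Prop :=
  ∀ e₁ ∈ L.P, ∀ e₂ ∈ L.P, e₁ ≠ e₂ → e₁.rid = e₂.rid → e₁.atom = e₂.atom →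
    ∀ W ∈ L.worlds, ¬ ((bodyF (L.rule e₁.rid).body).Sat W ∧ (bodyF e₁.cond).Sat W ∧
      (bodyF e₂.cond).Sat W)

/-! ### The probabilities of possible worlds -/

/-- The atom `A`, i.e. `c(u) = v`, is possible in `W` due to the random selection rule `r`. -/
def PossibleDueTo (L : PLog.{u, v, w} S) (W : Set (BaseAtom S)) (r : L.Rid) (A : S.Atom) : Prop :=
  A.1 = L.attr r ∧ (bodyF (L.rule r).body).Sat W ∧ (dynF (L.rule r).dyn A.2.1).Sat W ∧
    ¬ (interveneF A.1).Sat W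

def Possible (L : PLog.{u, v, w} S) (W : Set (BaseAtom S)) (A : S.Atom) : Prop :=
  ∃ r, L.PossibleDueTo W r A

/-- The pr-atom `e` is applied in `W`. -/
def Applied (L : PLog.{u, v, w} S) (W : Set (BaseAtom S)) (e : PrAtom L.rule) : Prop :=
  L.PossibleDueTo W e.rid e.atom ∧ (bodyF e.cond).Sat W

/-- `AV_W(c(u))`: the values `v` for which some pr-atom `pr_r(c(u) = v | C) = p` of the program is
applied in `W`. The body of the rule `r` of an applied pr-atom holds in `W`, so that `r` is the only
random selection rule for `c(u)` whose body does. -/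
def AV (L : PLog.{u, v, w} S) (W : Set (BaseAtom S)) (a : S.Attr) : Set (S.Range a) :=
  {x | ∃ e ∈ L.P, e.atom = ⟨a, x⟩ ∧ L.Applied W e}

/-- `PossWithAssPr(W, c(u) = v)`: the probability in the (unique) pr-atom for `c(u) = v` that is
applied in `W`. -/
def possWithAssPr (L : PLog.{u, v, w} S) (W : Set (BaseAtom S)) (A : S.Atom) : ℝ :=
  if h : ∃ e, e ∈ L.P ∧ e.atom = A ∧ L.Applied W e then (Classical.choose h).prob else 0

/-- `PossWithDefPr(W, c(u) = v)`: the default probability, the same for all the values of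
`a = c(u)` that are possible in `W` and have no assigned probability. -/
def possWithDefPr (L : PLog.{u, v, w} S) (W : Set (BaseAtom S)) (a : S.Attr) : ℝ :=
  max ((1 - ∑ x ∈ (Set.toFinite (L.AV W a)).toFinset, L.possWithAssPr W ⟨a, x⟩) /
    (Set.ncard {x : S.Range a | L.Possible W ⟨a, x⟩ ∧ x ∉ L.AV W a} : ℝ)) 0

/-- The probability `P(W, c(u) = v)` of an atom `c(u) = v` possible in `W` to happen in `W`. -/
def atomProb (L : PLog.{u, v, w} S) (W : Set (BaseAtom S)) (A : S.Atom) : ℝ :=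
  if A.2 ∈ L.AV W A.1 then L.possWithAssPr W A else L.possWithDefPr W A.1

/-- The unnormalized probability of a possible world. -/
def muHat (L : PLog.{u, v, w} S) (W : Set (BaseAtom S)) : ℝ :=
  ∏ A ∈ (Set.toFinite {A : S.Atom | BaseAtom.val A ∈ W ∧ L.Possible W A}).toFinset, L.atomProb W A

/-- The normalized probability of a possible world. -/
def mu (L : PLog.{u, v, w} S) (W : Set (BaseAtom S)) : ℝ :=
  L.muHat W / ∑ W' ∈ (Set.toFinite L.worlds).toFinset, L.muHat W'

/-- Consistency: some possible world has a nonzero probability. -/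
def Consistent (L : PLog.{u, v, w} S) : Prop := ∃ W ∈ L.worlds, L.mu W ≠ 0

/-! ### The translation into LP^MLN -/

/-- Attributes `c(u)` that have a random selection rule. -/
abbrev RAttr (L : PLog.{u, v, w} S) := {a : S.Attr // ∃ r, a = L.attr r}

/-- Atoms `c(u) = v` such that `c(u)` has a random selection rule. -/
abbrev RAtom (L : PLog.{u, v, w} S) := {A : S.Atom // ∃ r, A.1 = L.attr r}

/-- The triples `(r, C, c(u) = v)` that come from pr-atoms `pr_r(c(u) = v | C) = p` of the
program. -/
abbrev Key (L : PLog.{u, v, w} S) :=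
  {k : L.Rid × Finset S.Literal × S.Atom // k ∈ L.P.image fun e => (e.rid, e.cond, e.atom)}

/-- The possible remaining (unassigned) probabilities of `c(u)`: one minus the sum of the
probabilities in some set of pr-atoms for `c(u)`. -/
def pRem (L : PLog.{u, v, w} S) (a : S.Attr) : Finset ℝ :=
  (L.P.filter fun e => e.atom.1 = a).powerset.image fun X => 1 - ∑ e ∈ X, e.prob

/-- The auxiliary atoms of the translation. -/
inductive AuxAtom (L : PLog.{u, v, w} S) : Type (max u v w)
  /-- `Poss_r(c(u) = v)` -/
  | poss (r : L.Rid) (A : {A : S.Atom // A.1 = L.attr r}) : AuxAtom L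
  /-- `PossWithAssPr_{r,C}(c(u) = v)` -/
  | possWithAssPrOf (k : L.Key) : AuxAtom L
  /-- `AssPr_{r,C}(c(u) = v)` -/
  | assPr (k : L.Key) : AuxAtom L
  /-- `PossWithAssPr(c(u) = v)` -/
  | possWithAssPr (A : L.RAtom) : AuxAtom L
  /-- `PossWithDefPr(c(u) = v)` -/
  | possWithDefPr (A : L.RAtom) : AuxAtom L
  /-- `NumDefPr(c(u), m)`, for `m = 1, …, |Range(c)|` -/
  | numDefPr (a : L.RAttr) (m : {m : ℕ // m ∈ Finset.Icc 1 (S.range a.1.1).card}) : AuxAtom L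
  /-- `RemPr(c(u), k)` -/
  | remPr (a : L.RAttr) (k : {k : ℝ // k ∈ L.pRem a.1}) : AuxAtom L
  /-- `TotalDefPr(c(u), k)`, for `k > 0` -/
  | totalDefPr (a : L.RAttr) (k : {k : ℝ // k ∈ (L.pRem a.1).filter fun k => 0 < k}) : AuxAtom L

instance (L : PLog.{u, v, w} S) : Finite L.AuxAtom := by
  let f : (Σ r : L.Rid, {A : S.Atom // A.1 = L.attr r}) ⊕ L.Key ⊕ L.Key ⊕ L.RAtom ⊕ L.RAtom ⊕
      (Σ a : L.RAttr, {m : ℕ // m ∈ Finset.Icc 1 (S.range a.1.1).card}) ⊕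
      (Σ a : L.RAttr, {k : ℝ // k ∈ L.pRem a.1}) ⊕
      (Σ a : L.RAttr, {k : ℝ // k ∈ (L.pRem a.1).filter fun k => 0 < k}) → L.AuxAtom :=
    Sum.elim (fun t => .poss t.1 t.2) (Sum.elim .possWithAssPrOf (Sum.elim .assPr
      (Sum.elim .possWithAssPr (Sum.elim .possWithDefPr (Sum.elim (fun t => .numDefPr t.1 t.2)
        (Sum.elim (fun t => .remPr t.1 t.2) (fun t => .totalDefPr t.1 t.2)))))))
  refine Finite.of_surjective f ?_
  rintro (⟨r, A⟩ | k | k | A | A | ⟨a, m⟩ | ⟨a, k⟩ | ⟨a, k⟩)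
  · exact ⟨.inl ⟨r, A⟩, rfl⟩
  · exact ⟨.inr (.inl k), rfl⟩
  · exact ⟨.inr (.inr (.inl k)), rfl⟩
  · exact ⟨.inr (.inr (.inr (.inl A))), rfl⟩
  · exact ⟨.inr (.inr (.inr (.inr (.inl A)))), rfl⟩
  · exact ⟨.inr (.inr (.inr (.inr (.inr (.inl ⟨a, m⟩))))), rfl⟩
  · exact ⟨.inr (.inr (.inr (.inr (.inr (.inr (.inl ⟨a, k⟩)))))), rfl⟩
  · exact ⟨.inr (.inr (.inr (.inr (.inr (.inr (.inr ⟨a, k⟩)))))), rfl⟩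

/-- The atoms of the translation: those of `τ(L)` and the auxiliary ones. -/
abbrev MAtom (L : PLog.{u, v, w} S) := BaseAtom S ⊕ L.AuxAtom

/-- The restriction of an interpretation to the atoms of `τ(L)`. -/
def restrict {L : PLog.{u, v, w} S} (I : Set L.MAtom) : Set (BaseAtom S) := Sum.inl ⁻¹' I

section Translation

variable (L : PLog.{u, v, w} S)

/-- A formula of the signature of `τ(L)`, as a formula of the larger signature. -/
def base (F : Formula (BaseAtom S)) : Formula L.MAtom := F.map Sum.inl

def aux (x : L.AuxAtom) : Formula L.MAtom := .atom (Sum.inr x)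

/-- The atom `c(u) = v` for the attribute `c(u)` of the rule `r`. -/
abbrev ruleAtom (r : L.Rid) (x : S.Range (L.attr r)) : S.Atom := ⟨L.attr r, x⟩

abbrev ruleRAttr (r : L.Rid) : L.RAttr := ⟨L.attr r, r, rfl⟩

abbrev ruleRAtom (r : L.Rid) (x : S.Range (L.attr r)) : L.RAtom := ⟨L.ruleAtom r x, r, rfl⟩

/-- `Poss_r(c(u) = v)` -/
def possF (r : L.Rid) (x : S.Range (L.attr r)) : Formula L.MAtom :=
  L.aux (.poss r ⟨L.ruleAtom r x, rfl⟩)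

/-- The triple `(r, C, c(u) = v)` of a pr-atom. -/
abbrev keyOf (e : {e // e ∈ L.P}) : L.Key :=
  ⟨(e.1.rid, e.1.cond, e.1.atom), Finset.mem_image.2 ⟨e.1, e.2, rfl⟩⟩

/-- Identifiers of the random selection rules that have at least one associated pr-atom. -/
abbrev RidWithPr := {r : L.Rid // ∃ e ∈ L.P, e.rid = r}

/-- The hard rules of the translation, besides those of `τ(L)`. -/
def auxHard : Finset (Formula L.MAtom) :=
  -- `Poss_r(c(u) = v) ← Body, p(v), not Intervene(c(u))`
  (family fun t : Σ r : L.Rid, S.Range (L.attr r) =>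
    ((L.base (bodyF (L.rule t.1).body)).and ((L.base (dynF (L.rule t.1).dyn t.2.1)).and
      (L.base (interveneF (L.attr t.1))).neg)).imp (L.possF t.1 t.2)) ∪
  -- `PossWithAssPr_{r,C}(c(u) = v) ← Poss_r(c(u) = v), C`
  (family fun e : {e // e ∈ L.P} =>
    ((L.aux (.poss e.1.rid ⟨e.1.atom, e.1.attr_eq⟩)).and (L.base (bodyF e.1.cond))).imp
      (L.aux (.possWithAssPrOf (L.keyOf e)))) ∪
  -- `AssPr_{r,C}(c(u) = v) ← c(u) = v, PossWithAssPr_{r,C}(c(u) = v)`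
  (family fun e : {e // e ∈ L.P} =>
    ((L.base (valF e.1.atom)).and (L.aux (.possWithAssPrOf (L.keyOf e)))).imp
      (L.aux (.assPr (L.keyOf e)))) ∪
  -- `⊥ ← AssPr_{r,C}(c(u) = v)`, if `p = 0`
  (family fun e : {e : {e // e ∈ L.P} // e.1.prob = 0} =>
    (L.aux (.assPr (L.keyOf e.1))).imp .bot) ∪
  -- `PossWithAssPr(c(u) = v) ← PossWithAssPr_{r,C}(c(u) = v)`
  (family fun e : {e // e ∈ L.P} =>
    (L.aux (.possWithAssPrOf (L.keyOf e))).imp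
      (L.aux (.possWithAssPr ⟨e.1.atom, e.1.rid, e.1.attr_eq⟩))) ∪
  -- `PossWithDefPr(c(u) = v) ← Poss_r(c(u) = v), not PossWithAssPr(c(u) = v)`
  (family fun t : Σ r : L.Rid, S.Range (L.attr r) =>
    ((L.possF t.1 t.2).and (L.aux (.possWithAssPr (L.ruleRAtom t.1 t.2))).neg).imp
      (L.aux (.possWithDefPr (L.ruleRAtom t.1 t.2)))) ∪
  -- `NumDefPr(c(u), m) ← c(u) = v, PossWithDefPr(c(u) = v),`
  -- `m = #count {y : PossWithDefPr(c(u) = y)}`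
  (family fun t : Σ r : L.Rid, S.Range (L.attr r) ×
      {m : ℕ // m ∈ Finset.Icc 1 (S.range (L.attr r).1).card} =>
    ((L.base (valF (L.ruleAtom t.1 t.2.1))).and
      ((L.aux (.possWithDefPr (L.ruleRAtom t.1 t.2.1))).and
        (Formula.countEq (fun y : S.Range (L.attr t.1) =>
          L.aux (.possWithDefPr (L.ruleRAtom t.1 y))) t.2.2.1))).imp
      (L.aux (.numDefPr (L.ruleRAttr t.1) t.2.2))) ∪
  -- `RemPr(c(u), k) ← Body, c(u) = v, PossWithDefPr(c(u) = v), 1 - k = #sum {…}`, where the sum is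
  -- over the pr-atoms `pr_r(c(u) = vᵢ | Cᵢ) = pᵢ` of `r`, with elements
  -- `pᵢ : PossWithAssPr_{r,Cᵢ}(c(u) = vᵢ)`
  (family fun t : Σ r : L.RidWithPr, S.Range (L.attr r.1) × {k : ℝ // k ∈ L.pRem (L.attr r.1)} =>
    ((L.base (bodyF (L.rule t.1.1).body)).and ((L.base (valF (L.ruleAtom t.1.1 t.2.1))).and
      ((L.aux (.possWithDefPr (L.ruleRAtom t.1.1 t.2.1))).and
        (Formula.sumEq (fun e : {e : {e // e ∈ L.P} // e.1.rid = t.1.1} =>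
          L.aux (.possWithAssPrOf (L.keyOf e.1))) (fun e => e.1.1.prob) (1 - t.2.2.1))))).imp
      (L.aux (.remPr (L.ruleRAttr t.1.1) t.2.2))) ∪
  -- `TotalDefPr(c(u), k) ← RemPr(c(u), k)`, if `k > 0`
  (family fun t : Σ r : L.RidWithPr,
      {k : ℝ // k ∈ (L.pRem (L.attr r.1)).filter fun k => 0 < k} =>
    (L.aux (.remPr (L.ruleRAttr t.1.1) ⟨t.2.1, Finset.mem_of_mem_filter _ t.2.2⟩)).imp
      (L.aux (.totalDefPr (L.ruleRAttr t.1.1) t.2))) ∪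
  -- `⊥ ← RemPr(c(u), k)`, if `k ≤ 0`
  (family fun t : Σ r : L.RidWithPr, {k : {k : ℝ // k ∈ L.pRem (L.attr r.1)} // k.1 ≤ 0} =>
    (L.aux (.remPr (L.ruleRAttr t.1.1) t.2.1)).imp .bot)

/-- The soft rules of the translation. -/
def auxSoft : Finset (ℝ × Formula L.MAtom) :=
  -- `ln p : ⊥ ← not AssPr_{r,C}(c(u) = v)`, if `p > 0`
  (family fun e : {e : {e // e ∈ L.P} // 0 < e.1.prob} =>
    (Real.log e.1.1.prob, (L.aux (.assPr (L.keyOf e.1))).neg.imp .bot)) ∪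
  -- `ln (1 / m) : ⊥ ← not NumDefPr(c(u), m)`, for `m = 2, …, |Range(c)|`
  (family fun t : Σ r : L.Rid,
      {m : {m : ℕ // m ∈ Finset.Icc 1 (S.range (L.attr r).1).card} // 2 ≤ m.1} =>
    (Real.log (1 / (t.2.1.1 : ℝ)),
      (L.aux (.numDefPr (L.ruleRAttr t.1) t.2.1)).neg.imp .bot)) ∪
  -- `ln k : ⊥ ← not TotalDefPr(c(u), k)`
  (family fun t : Σ r : L.RidWithPr,
      {k : ℝ // k ∈ (L.pRem (L.attr r.1)).filter fun k => 0 < k} =>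
    (Real.log t.2.1, (L.aux (.totalDefPr (L.ruleRAttr t.1.1) t.2)).neg.imp .bot))

/-- The LP^MLN program `plog2lpmln(L)`. -/
def plog2lpmln : LPMLN L.MAtom :=
  (L.tau.image fun F => (Weight.hard, L.base F)) ∪
  (L.auxHard.image fun F => (Weight.hard, F)) ∪
  (L.auxSoft.image fun x => (Weight.soft x.1, x.2))

end Translation

end PLog

end

end PLogMLN

/-! The translation adds to `τ(Π)` a stratified layer of definitions plus weights, and each claim
about it reduces to one possible world `W`.

Apart from constraints, the hard auxiliary rules define each auxiliary atom from the original atoms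
and auxiliary atoms of lower level. Hence (`isStableModel_union_layered`) a stable model of the hard
rules is a stable model of `τ(Π)` whose auxiliary atoms are exactly those supported by a rule. By
induction on levels these truth values are forced to be `AuxHolds`, so the model is `extend W` for a
possible world `W`, and the constraints say that `W` is `Admissible`. The constraints exclude a true
atom with assigned probability 0, or with default probability and no positive mass left. These are
the only ways in which a factor of `muHat W` can vanish (`admissible_iff`).

The soft rules `⊥ ← not x` are double negations: once satisfied, their reducts are tautologies, so
they contribute weight without affecting stability (`LPMLN.mem_hardSM_iff`). As `α → ∞`, an
interpretation violating a hard rule is exponentially outweighed by one satisfying all of them;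
consistency provides one, so the limits exist and are ratios of exponentials of soft weights
(`LPMLN.tendsto_ratio`).

It remains to see that the exponential of the soft weight of `extend W` is `muHat W`
(`exp_softSum`). Grouped by attribute, the satisfied soft rules contribute either `ln q` for the
applied pr-atom, or `ln (1/m)` and `ln` of the remaining mass. Either sum is the logarithm of the
factor of `muHat W` for that attribute. Restriction and `extend` are then the bijection, and the
normalizing sums agree. -/

namespace PLogMLN

noncomputable section

open scoped Classical

/-! ### Satisfaction and reducts of formulas -/

namespace Formula

variable {α : Type u} {β : Type v} {ι : Type w}

theorem sat_neg {I : Set α} {F : Formula α} : F.neg.Sat I ↔ ¬ F.Sat I := Iff.rfl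

theorem sat_top {I : Set α} : (top : Formula α).Sat I := fun h => h

theorem sat_conj {I : Set α} {s : Finset ι} {f : ι → Formula α} :
    (conj s f).Sat I ↔ ∀ i ∈ s, (f i).Sat I := by
  have key : ∀ l : List ι, (l.foldr (fun i G => and (f i) G) top).Sat I ↔
      ∀ i ∈ l, (f i).Sat I := by
    intro l
    induction l with
    | nil => simp [sat_top]
    | cons i l ih => simp [Sat, ih]
  simpa [conj] using key s.toList

theorem sat_disj {I : Set α} {s : Finset ι} {f : ι → Formula α} :
    (disj s f).Sat I ↔ ∃ i ∈ s, (f i).Sat I := by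
  have key : ∀ l : List ι, (l.foldr (fun i G => or (f i) G) bot).Sat I ↔
      ∃ i ∈ l, (f i).Sat I := by
    intro l
    induction l with
    | nil => simp [Sat]
    | cons i l ih => simp [Sat, ih]
  simpa [disj] using key s.toList

theorem sat_map {g : α → β} {I : Set β} {F : Formula α} :
    (F.map g).Sat I ↔ F.Sat (g ⁻¹' I) := by
  induction F with
  | bot => rfl
  | atom a => rfl
  | and F G hF hG => simp only [map, Sat, hF, hG]
  | or F G hF hG => simp only [map, Sat, hF, hG]
  | imp F G hF hG => simp only [map, Sat, hF, hG]

theorem reduct_map {g : α → β} {I : Set β} {F : Formula α} :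
    (F.map g).reduct I = (F.reduct (g ⁻¹' I)).map g := by
  induction F with
  | bot => rfl
  | atom a => simp only [map, reduct, Set.mem_preimage]; split_ifs <;> rfl
  | and F G hF hG =>
    have hs : ((map g F).and (map g G)).Sat I ↔ (and F G).Sat (g ⁻¹' I) :=
      sat_map (F := and F G)
    simp only [map, reduct, hs, hF, hG]
    split_ifs <;> rfl
  | or F G hF hG =>
    have hs : ((map g F).or (map g G)).Sat I ↔ (or F G).Sat (g ⁻¹' I) :=
      sat_map (F := or F G)
    simp only [map, reduct, hs, hF, hG]
    split_ifs <;> rfl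
  | imp F G hF hG =>
    have hs : ((map g F).imp (map g G)).Sat I ↔ (imp F G).Sat (g ⁻¹' I) :=
      sat_map (F := imp F G)
    simp only [map, reduct, hs, hF, hG]
    split_ifs <;> rfl

/-- A formula whose reduct with respect to `I` is satisfiable is satisfied by `I`. -/
theorem Sat.of_reduct {I J : Set α} {F : Formula α} (h : (F.reduct I).Sat J) : F.Sat I := by
  by_contra hF
  cases F with
  | bot => exact h
  | atom a => rw [reduct, if_neg (show a ∉ I from hF)] at h; exact h
  | and F G => rw [reduct, if_neg hF] at h; exact h
  | or F G => rw [reduct, if_neg hF] at h; exact h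
  | imp F G => rw [reduct, if_neg hF] at h; exact h

/-- All atoms of the formula belong to `p`. -/
def AtomsIn (p : Set α) : Formula α → Prop
  | bot => True
  | atom a => a ∈ p
  | and F G => AtomsIn p F ∧ AtomsIn p G
  | or F G => AtomsIn p F ∧ AtomsIn p G
  | imp F G => AtomsIn p F ∧ AtomsIn p G

/-- If `J` agrees with `I` on the atoms of `F`, then `J` satisfies the reduct `F^I` if and only
if `I` satisfies `F`. -/
theorem sat_reduct_of_agree {p I J : Set α} {F : Formula α} (hF : F.AtomsIn p)
    (h : ∀ a ∈ p, a ∈ J ↔ a ∈ I) : (F.reduct I).Sat J ↔ F.Sat I := by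
  induction F with
  | bot => rfl
  | atom a =>
    by_cases ha : a ∈ I
    · simpa [reduct, Sat, ha] using h a hF
    · simp [reduct, Sat, ha]
  | and F G iF iG =>
    have iF := iF hF.1
    have iG := iG hF.2
    by_cases hs : (and F G).Sat I
    · simp only [reduct, if_pos hs]; simp only [Sat, iF, iG]
    · exact iff_of_false (fun h => hs (Sat.of_reduct h)) hs
  | or F G iF iG =>
    have iF := iF hF.1
    have iG := iG hF.2
    by_cases hs : (or F G).Sat I
    · simp only [reduct, if_pos hs]; simp only [Sat, iF, iG]
    · exact iff_of_false (fun h => hs (Sat.of_reduct h)) hs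
  | imp F G iF iG =>
    have iF := iF hF.1
    have iG := iG hF.2
    by_cases hs : (imp F G).Sat I
    · simp only [reduct, if_pos hs]; simp only [Sat, iF, iG]
    · exact iff_of_false (fun h => hs (Sat.of_reduct h)) hs

theorem atomsIn_univ (F : Formula α) : F.AtomsIn Set.univ := by
  induction F with
  | bot => trivial
  | atom a => trivial
  | and F G hF hG => exact ⟨hF, hG⟩
  | or F G hF hG => exact ⟨hF, hG⟩
  | imp F G hF hG => exact ⟨hF, hG⟩

theorem sat_reduct_self {I : Set α} {F : Formula α} : (F.reduct I).Sat I ↔ F.Sat I :=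
  sat_reduct_of_agree F.atomsIn_univ fun _ _ => Iff.rfl

theorem atomsIn_map {g : α → β} {p : Set β} (h : ∀ a, g a ∈ p) (F : Formula α) :
    (F.map g).AtomsIn p := by
  induction F with
  | bot => trivial
  | atom a => exact h a
  | and F G hF hG => exact ⟨hF, hG⟩
  | or F G hF hG => exact ⟨hF, hG⟩
  | imp F G hF hG => exact ⟨hF, hG⟩

theorem atomsIn_conj {p : Set α} {s : Finset ι} {f : ι → Formula α} (h : ∀ i, (f i).AtomsIn p) :
    (conj s f).AtomsIn p := by
  unfold conj
  induction s.toList with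
  | nil => exact ⟨trivial, trivial⟩
  | cons i l ih => exact ⟨h i, ih⟩

theorem atomsIn_disj {p : Set α} {s : Finset ι} {f : ι → Formula α} (h : ∀ i, (f i).AtomsIn p) :
    (disj s f).AtomsIn p := by
  unfold disj
  induction s.toList with
  | nil => trivial
  | cons i l ih => exact ⟨h i, ih⟩

theorem atomsIn_sumEq [Finite ι] {p : Set α} {F : ι → Formula α} {q : ι → ℝ} {y : ℝ}
    (h : ∀ i, (F i).AtomsIn p) : (sumEq F q y).AtomsIn p :=
  atomsIn_conj fun _ => ⟨atomsIn_conj h, atomsIn_disj h⟩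

theorem sat_sumEq [Finite ι] {I : Set α} {F : ι → Formula α} {p : ι → ℝ} {y : ℝ} :
    (sumEq F p y).Sat I ↔ ∑ i ∈ (Set.toFinite {i | (F i).Sat I}).toFinset, p i = y := by
  simp only [sumEq, sat_conj, Sat, sat_disj, Set.Finite.mem_toFinset, Set.mem_ofPred_eq]
  constructor
  · intro h
    by_contra hne
    -- The set of all true indices is the only one whose implication fails: all its members hold and
    -- nothing outside it does.
    obtain ⟨i, hi, hs⟩ := h _ hne (fun i hi => by simpa using hi)
    exact hi (by simpa using hs)
  · intro h X hX hs
    by_contra! hc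
    refine hX ?_
    rw [← h]
    refine Finset.sum_congr ?_ fun _ _ => rfl
    ext i
    simp only [Set.Finite.mem_toFinset, Set.mem_ofPred_eq]
    exact ⟨hs i, fun hi => by_contra fun hn => hc i hn hi⟩

theorem sat_countEq [Finite ι] {I : Set α} {F : ι → Formula α} {m : ℕ} :
    (countEq F m).Sat I ↔ {i | (F i).Sat I}.ncard = m := by
  rw [countEq, sat_sumEq, Finset.sum_const, nsmul_eq_mul, mul_one, Nat.cast_inj,
    Set.ncard_eq_toFinset_card _ (Set.toFinite _)]

/-- The reduct of a satisfied double negation is a tautology. -/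
theorem sat_reduct_neg_neg {I J : Set α} {F : Formula α} (h : (F.neg.imp bot).Sat I) :
    ((F.neg.imp bot).reduct I).Sat J := by
  rw [reduct, if_pos h]
  exact fun hn => absurd (Sat.of_reduct hn) h

end Formula

/-! ### Splitting off a stratified layer of rules -/

open Formula

variable {α : Type u} {β : Type v}

theorem isStableModel_iff {Γ : Set (Formula α)} {I : Set α} :
    IsStableModel Γ I ↔ (∀ F ∈ Γ, F.Sat I) ∧
      ∀ J : Set α, J ⊆ I → (∀ F ∈ Γ, (F.reduct I).Sat J) → J = I := by
  simp only [IsStableModel, sat_reduct_self]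

/-- A constraint, or a rule for an atom of `β` whose body mentions, besides the atoms of `α`, only
atoms of `β` of lower level than the head. -/
def IsLayeredRule (lev : β → ℕ) (F : Formula (α ⊕ β)) : Prop :=
  (∃ B, F = imp B bot) ∨ ∃ B x, F = imp B (atom (Sum.inr x)) ∧
    B.AtomsIn {z | ∀ y, z = Sum.inr y → lev y < lev x}

theorem sat_reduct_imp {I J : Set α} {B H : Formula α} (h : (imp B H).Sat I) :
    ((imp B H).reduct I).Sat J ↔ ((B.reduct I).Sat J → (H.reduct I).Sat J) := by
  rw [reduct, if_pos h]; rfl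

/-- If `J` satisfies the reduct of a body, then `I` satisfies the body itself. So constraints
survive in the reduct for free, and `J` only has to contain the heads of the rules that fire in `I`.
This produces the competitors against which minimality of `I` is tested. -/
theorem sat_reduct_layered {lev : β → ℕ} {Δ : Set (Formula (α ⊕ β))}
    (hΔ : ∀ F ∈ Δ, IsLayeredRule lev F) {I J : Set (α ⊕ β)} (hI : ∀ F ∈ Δ, F.Sat I)
    (hJ : ∀ B x, imp B (atom (Sum.inr x)) ∈ Δ → B.Sat I → Sum.inr x ∈ J) :
    ∀ F ∈ Δ, (F.reduct I).Sat J := by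
  intro F hF
  rcases hΔ F hF with ⟨B, rfl⟩ | ⟨B, x, rfl, -⟩
  · rw [sat_reduct_imp (hI _ hF)]
    exact fun h => absurd (Sat.of_reduct h) (hI _ hF)
  · rw [sat_reduct_imp (hI _ hF)]
    intro h
    have hB := Sat.of_reduct h
    have hx : Sum.inr x ∈ I := hI _ hF hB
    rw [reduct, if_pos hx]
    exact hJ B x hF hB

/-- Splitting: stable models of a program over `α` extended by layered rules. -/
theorem isStableModel_union_layered {lev : β → ℕ} {Γ : Set (Formula α)}
    {Δ : Set (Formula (α ⊕ β))} (hΔ : ∀ F ∈ Δ, IsLayeredRule lev F) {I : Set (α ⊕ β)} :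
    IsStableModel (map Sum.inl '' Γ ∪ Δ) I ↔ IsStableModel Γ (Sum.inl ⁻¹' I) ∧
      (∀ F ∈ Δ, F.Sat I) ∧
      ∀ x, Sum.inr x ∈ I → ∃ B, imp B (atom (Sum.inr x)) ∈ Δ ∧ B.Sat I := by
  simp only [isStableModel_iff]
  constructor
  · rintro ⟨hm, hmin⟩
    have hmΔ : ∀ F ∈ Δ, F.Sat I := fun F hF => hm F (Or.inr hF)
    have hmΓ : ∀ F ∈ Γ, F.Sat (Sum.inl ⁻¹' I) := fun F hF =>
      sat_map.1 (hm _ (Or.inl ⟨F, hF, rfl⟩))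
    refine ⟨⟨hmΓ, fun J hJ hJm => ?_⟩, hmΔ, fun x hx => ?_⟩
    -- The competitor is `J` together with all auxiliary atoms of `I`: the layered rules hold in it,
    -- so minimality of `I` is minimality of its original part.
    · have := hmin {z | z ∈ I ∧ ∀ a, z = Sum.inl a → a ∈ J} (fun z hz => hz.1) (by
        rintro F (⟨F, hF, rfl⟩ | hF)
        · rw [reduct_map, sat_map]
          convert hJm F hF using 1
          ext a
          exact ⟨fun h => h.2 a rfl, fun h => ⟨hJ h, fun b hb => Sum.inl.inj hb ▸ h⟩⟩
        · refine sat_reduct_layered hΔ hmΔ (fun B x hB hs => ?_) F hF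
          exact ⟨hmΔ _ hB hs, fun a h => by cases h⟩)
      refine hJ.antisymm fun a ha => ?_
      have ha' : Sum.inl a ∈ I := ha
      rw [← this] at ha'
      exact ha'.2 a rfl
    · by_contra! hc
      -- An unsupported `x` can be removed: no rule with head `x` fires in `I`, and the original
      -- atoms are untouched.
      have := hmin (I \ {Sum.inr x}) Set.sdiff_subset (by
        rintro F (⟨F, hF, rfl⟩ | hF)
        · rw [reduct_map, sat_map]
          have : (Sum.inl ⁻¹' (I \ {Sum.inr x}) : Set α) = Sum.inl ⁻¹' I := by
            ext a; simp
          rw [this]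
          exact sat_reduct_self.2 (hmΓ F hF)
        · refine sat_reduct_layered hΔ hmΔ (fun B y hB hs => ?_) F hF
          refine ⟨hmΔ _ hB hs, fun h => ?_⟩
          obtain rfl : y = x := Sum.inr.inj h
          exact hc B hB hs)
      rw [← this] at hx
      exact hx.2 rfl
  · rintro ⟨⟨hmΓ, hmin⟩, hmΔ, hsupp⟩
    refine ⟨?_, fun J hJ hJm => ?_⟩
    · rintro F (⟨F, hF, rfl⟩ | hF)
      · exact sat_map.2 (hmΓ F hF)
      · exact hmΔ F hF
    · have hbase := hmin (Sum.inl ⁻¹' J) (fun a ha => hJ ha) (fun F hF => by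
        have := hJm _ (Or.inl ⟨F, hF, rfl⟩)
        rwa [reduct_map, sat_map] at this)
      -- `J` agrees with `I` on the original atoms and, by induction, below the level of `x`. So the
      -- reduct of a supporting body holds in `J`, and the reduced rule puts `x` into `J`.
      have haux : ∀ n x, lev x = n → Sum.inr x ∈ I → Sum.inr x ∈ J := by
        intro n
        induction n using Nat.strong_induction_on with
        | _ n ih =>
        intro x hn hx
        obtain ⟨B, hB, hs⟩ := hsupp x hx
        have h := hJm _ (Or.inr hB)
        rw [sat_reduct_imp (hmΔ _ hB), reduct, if_pos hx] at h
        refine h ?_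
        rcases hΔ _ hB with ⟨B', h'⟩ | ⟨B', x', h', hat⟩
        · cases h'
        · cases h'
          refine (sat_reduct_of_agree hat ?_).2 hs
          intro z hz
          refine ⟨fun h => hJ h, fun h => ?_⟩
          rcases z with a | y
          · have : a ∈ (Sum.inl ⁻¹' I : Set α) := h
            rwa [← hbase] at this
          · exact ih _ (hn ▸ hz y rfl) y rfl h
      refine hJ.antisymm fun z hz => ?_
      rcases z with a | x
      · have : a ∈ (Sum.inl ⁻¹' I : Set α) := hz
        rwa [← hbase] at this
      · exact haux _ x rfl hz

/-! ### The limit `α → ∞` and the role of soft rules -/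

namespace LPMLN

/-- The sum of the soft weights of the satisfied formulas. -/
def softSum (Q : LPMLN α) (I : Set α) : ℝ := ∑ x ∈ Q.satisfied I, x.1.val 0

/-- The elements of `SM[Q]` that satisfy all hard formulas. -/
def hardSM (Q : LPMLN α) : Set (Set α) :=
  {I | I ∈ Q.SM ∧ ∀ x ∈ Q, x.1 = Weight.hard → x.2.Sat I}

theorem sum_val (s : LPMLN α) (a : ℝ) :
    ∑ x ∈ s, x.1.val a = (s.filter fun x => x.1 = Weight.hard).card * a + ∑ x ∈ s, x.1.val 0 := by
  rw [← nsmul_eq_mul, ← Finset.sum_const, Finset.sum_filter, ← Finset.sum_add_distrib]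
  refine Finset.sum_congr rfl fun x _ => ?_
  rcases x with ⟨_ | w, F⟩ <;> simp [Weight.val]

/-- The weights relative to the largest conceivable order of growth converge. -/
theorem tendsto_weight_div (Q : LPMLN α) (I : Set α) :
    Filter.Tendsto
      (fun a => Q.weight a I / Real.exp ((Q.filter fun x => x.1 = Weight.hard).card * a))
      Filter.atTop (nhds (if I ∈ Q.hardSM then Real.exp (Q.softSum I) else 0)) := by
  by_cases hI : I ∈ Q.SM
  swap
  · rw [if_neg fun h => hI h.1]
    simp [weight, hI]
  have hsub : ((Q.satisfied I).filter fun x => x.1 = Weight.hard) ⊆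
      Q.filter fun x => x.1 = Weight.hard :=
    Finset.filter_subset_filter _ (Finset.filter_subset _ _)
  -- The exponent is linear in `a`; its slope is minus the number of violated hard formulas.
  have hw : ∀ a, Q.weight a I / Real.exp ((Q.filter fun x => x.1 = Weight.hard).card * a) =
      Real.exp (Q.softSum I) * Real.exp ((((Q.satisfied I).filter fun x => x.1 = Weight.hard).card -
        (Q.filter fun x => x.1 = Weight.hard).card : ℝ) * a) := by
    intro a
    rw [weight, if_pos hI, sum_val, ← Real.exp_sub, ← Real.exp_add, softSum]
    ring_nf
  simp only [hw]
  split_ifs with h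
  · have : ((Q.satisfied I).filter fun x => x.1 = Weight.hard) =
        Q.filter fun x => x.1 = Weight.hard := by
      refine hsub.antisymm fun x hx => ?_
      simp only [Finset.mem_filter] at hx
      simp only [satisfied, Finset.mem_filter]
      exact ⟨⟨hx.1, h.2 x hx.1 hx.2⟩, hx.2⟩
    simp [this]
  · have hlt : (((Q.satisfied I).filter fun x => x.1 = Weight.hard).card -
        (Q.filter fun x => x.1 = Weight.hard).card : ℝ) < 0 := by
      rw [sub_neg, Nat.cast_lt]
      refine Finset.card_lt_card (hsub.ssubset_of_ne fun heq => h ⟨hI, fun x hx hh => ?_⟩)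
      have : x ∈ Q.filter fun x => x.1 = Weight.hard := Finset.mem_filter.2 ⟨hx, hh⟩
      rw [← heq] at this
      exact (Finset.mem_filter.1 (Finset.mem_filter.1 this).1).2
    have := Real.tendsto_exp_atBot.comp
      (Filter.tendsto_id.const_mul_atTop_of_neg (f := fun a : ℝ => a) hlt)
    simpa using this.const_mul (Real.exp (Q.softSum I))

/-- If some element of `SM[Q]` satisfies all hard formulas, then only such elements have
positive probability, and their probability is determined by the soft weights. -/
theorem tendsto_ratio [Finite α] (Q : LPMLN α) (hQ : Q.hardSM.Nonempty) (I : Set α) :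
    Filter.Tendsto (Q.ratio I) Filter.atTop
      (nhds ((if I ∈ Q.hardSM then Real.exp (Q.softSum I) else 0) /
        ∑ J ∈ (Set.toFinite Q.hardSM).toFinset, Real.exp (Q.softSum J))) := by
  have hsum : ∑ J ∈ (Set.toFinite Q.SM).toFinset,
        (if J ∈ Q.hardSM then Real.exp (Q.softSum J) else 0) =
      ∑ J ∈ (Set.toFinite Q.hardSM).toFinset, Real.exp (Q.softSum J) := by
    rw [← Finset.sum_filter]
    refine Finset.sum_congr ?_ fun _ _ => rfl
    ext J
    simp only [Finset.mem_filter, Set.Finite.mem_toFinset]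
    exact ⟨fun h => h.2, fun h => ⟨h.1, h⟩⟩
  have hpos : 0 < ∑ J ∈ (Set.toFinite Q.hardSM).toFinset, Real.exp (Q.softSum J) :=
    Finset.sum_pos (fun _ _ => Real.exp_pos _) (by simpa using hQ)
  have h2 := tendsto_finsetSum (Set.toFinite Q.SM).toFinset
    fun J _ => Q.tendsto_weight_div J
  rw [hsum] at h2
  -- Numerator and denominator are divided by the same exponential; the limiting denominator is
  -- positive because `hardSM` is nonempty.
  refine ((Q.tendsto_weight_div I).div h2 hpos.ne').congr fun a => ?_
  simp only [Pi.div_apply, ratio]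
  rw [← Finset.sum_div, div_div_div_cancel_right₀ (Real.exp_pos _).ne']

theorem prob_eq [Finite α] (Q : LPMLN α) (hQ : Q.hardSM.Nonempty) (I : Set α) :
    Q.prob I = (if I ∈ Q.hardSM then Real.exp (Q.softSum I) else 0) /
      ∑ J ∈ (Set.toFinite Q.hardSM).toFinset, Real.exp (Q.softSum J) :=
  (Q.tendsto_ratio hQ I).limUnder_eq

theorem isProbStableModel_iff [Finite α] (Q : LPMLN α) (hQ : Q.hardSM.Nonempty) (I : Set α) :
    Q.IsProbStableModel I ↔ I ∈ Q.hardSM := by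
  have hpos : 0 < ∑ J ∈ (Set.toFinite Q.hardSM).toFinset, Real.exp (Q.softSum J) :=
    Finset.sum_pos (fun _ _ => Real.exp_pos _) (by simpa using hQ)
  rw [IsProbStableModel, Q.prob_eq hQ, div_ne_zero_iff, and_iff_left hpos.ne']
  split_ifs with h <;> simp [h, Real.exp_ne_zero]

/-- Soft double negations do not affect which interpretations are stable models of the hard
part. -/
theorem mem_hardSM_iff {H : Finset (Formula α)} {T : Finset (ℝ × Formula α)}
    (hT : ∀ x ∈ T, ∃ F : Formula α, x.2 = F.neg.imp bot) {I : Set α} :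
    I ∈ hardSM ((H.image fun F => (Weight.hard, F)) ∪ T.image fun x => (Weight.soft x.1, x.2)) ↔
      IsStableModel {F | F ∈ H} I := by
  have hmem : ∀ F, (∃ x ∈ satisfied ((H.image fun F => (Weight.hard, F)) ∪
      T.image fun x => (Weight.soft x.1, x.2)) I, x.2 = F) ↔
      F.Sat I ∧ (F ∈ H ∨ ∃ q, (q, F) ∈ T) := by
    intro F
    simp only [satisfied, Finset.mem_filter, Finset.mem_union, Finset.mem_image]
    constructor
    · rintro ⟨x, ⟨⟨G, hG, rfl⟩ | ⟨y, hy, rfl⟩, hs⟩, rfl⟩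
      · exact ⟨hs, Or.inl hG⟩
      · exact ⟨hs, Or.inr ⟨y.1, hy⟩⟩
    · rintro ⟨hs, hF | ⟨q, hq⟩⟩
      · exact ⟨(Weight.hard, F), ⟨Or.inl ⟨F, hF, rfl⟩, hs⟩, rfl⟩
      · exact ⟨(Weight.soft q, F), ⟨Or.inr ⟨_, hq, rfl⟩, hs⟩, rfl⟩
  simp only [hardSM, SM, hmem, isStableModel_iff, Set.mem_ofPred_eq]
  constructor
  · rintro ⟨⟨h1, h2⟩, h3⟩
    have hH : ∀ F ∈ H, F.Sat I := fun F hF =>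
      h3 (Weight.hard, F) (Finset.mem_union_left _ (Finset.mem_image_of_mem _ hF)) rfl
    refine ⟨hH, fun J hJ hJm => h2 J hJ ?_⟩
    rintro F ⟨hs, hF | ⟨q, hq⟩⟩
    · exact hJm F hF
    · obtain ⟨G, rfl⟩ := hT _ hq
      exact sat_reduct_neg_neg hs
  · rintro ⟨h1, h2⟩
    refine ⟨⟨fun F hF => hF.1, fun J hJ hJm => h2 J hJ fun F hF => hJm F ⟨h1 F hF, Or.inl hF⟩⟩, ?_⟩
    intro x hx hh
    simp only [Finset.mem_union, Finset.mem_image] at hx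
    rcases hx with ⟨G, hG, rfl⟩ | ⟨y, hy, rfl⟩
    · exact h1 G hG
    · cases hh

/-- Hard weights count as 0 in `softSum`. Soft rules are kept as pairs, so equal weights on
different formulas are not merged. -/
theorem softSum_eq {H : Finset (Formula α)} {T : Finset (ℝ × Formula α)} {I : Set α} :
    softSum ((H.image fun F => (Weight.hard, F)) ∪ T.image fun x => (Weight.soft x.1, x.2)) I =
      ∑ x ∈ T with x.2.Sat I, x.1 := by
  rw [softSum, satisfied, Finset.sum_filter, Finset.sum_union, Finset.sum_image, Finset.sum_image,
    Finset.sum_filter]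
  · simp [Weight.val]
  · rintro ⟨a, F⟩ - ⟨b, G⟩ - h
    simpa using h
  · rintro F - G - h
    simpa using h
  · rw [Finset.disjoint_left]
    intro x hx hx'
    simp only [Finset.mem_image] at hx hx'
    obtain ⟨F, -, rfl⟩ := hx
    obtain ⟨y, -, h⟩ := hx'
    simp at h

end LPMLN

theorem mem_family {ι : Type u} {β : Type v} [Finite ι] {f : ι → β} {y : β} :
    y ∈ family f ↔ ∃ i, f i = y := by
  simp [family]

/-! ### Intended truth values of the auxiliary atoms -/

namespace PLog

variable {S : Sig.{u, v}} (L : PLog.{u, v, w} S)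

/-- `A` is possible in `W` and no pr-atom is applied to it. -/
def DefaultPossible (W : Set (BaseAtom S)) (A : S.Atom) : Prop :=
  L.Possible W A ∧ A.2 ∉ L.AV W A.1

/-- The truth in `W` of `RemPr(a, k)`. -/
def RemHolds (W : Set (BaseAtom S)) (a : S.Attr) (k : ℝ) : Prop :=
  ∃ r, L.attr r = a ∧ (∃ e ∈ L.P, e.rid = r) ∧ (bodyF (L.rule r).body).Sat W ∧
    (∃ x, BaseAtom.val ⟨a, x⟩ ∈ W ∧ L.DefaultPossible W ⟨a, x⟩) ∧
    ∑ e ∈ L.P with e.rid = r ∧ L.Applied W e, e.prob = 1 - k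

/-- The truth values of the auxiliary atoms that are determined by an interpretation `W` of the
original atoms. -/
def AuxHolds (W : Set (BaseAtom S)) : L.AuxAtom → Prop
  | .poss r A => L.PossibleDueTo W r A.1
  | .possWithAssPrOf k => L.PossibleDueTo W k.1.1 k.1.2.2 ∧ (bodyF k.1.2.1).Sat W
  | .assPr k => BaseAtom.val k.1.2.2 ∈ W ∧ L.PossibleDueTo W k.1.1 k.1.2.2 ∧
      (bodyF k.1.2.1).Sat W
  | .possWithAssPr A => A.1.2 ∈ L.AV W A.1.1
  | .possWithDefPr A => L.DefaultPossible W A.1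
  | .numDefPr a m => (∃ x, BaseAtom.val ⟨a.1, x⟩ ∈ W ∧ L.DefaultPossible W ⟨a.1, x⟩) ∧
      {x : S.Range a.1 | L.DefaultPossible W ⟨a.1, x⟩}.ncard = m.1
  | .remPr a k => L.RemHolds W a.1 k.1
  | .totalDefPr a k => L.RemHolds W a.1 k.1

/-- The stratification of the auxiliary atoms. -/
def level : L.AuxAtom → ℕ
  | .poss _ _ => 0
  | .possWithAssPrOf _ => 1
  | .assPr _ => 2
  | .possWithAssPr _ => 2
  | .possWithDefPr _ => 3
  | .numDefPr _ _ => 4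
  | .remPr _ _ => 4
  | .totalDefPr _ _ => 5

/-- The extension of an interpretation of the original atoms to the auxiliary atoms. -/
def extend (W : Set (BaseAtom S)) : Set L.MAtom := {z | Sum.elim (· ∈ W) (L.AuxHolds W) z}

variable {L}

theorem inr_mem_extend {W : Set (BaseAtom S)} {x : L.AuxAtom} :
    (Sum.inr x : L.MAtom) ∈ L.extend W ↔ L.AuxHolds W x := Iff.rfl

theorem restrict_extend (W : Set (BaseAtom S)) : restrict (L.extend W) = W := rfl

theorem sat_base {I : Set L.MAtom} {F : Formula (BaseAtom S)} :
    (L.base F).Sat I ↔ F.Sat (restrict I) := sat_map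

theorem sat_aux {I : Set L.MAtom} {x : L.AuxAtom} : (L.aux x).Sat I ↔ Sum.inr x ∈ I := Iff.rfl

theorem sat_possF {I : Set L.MAtom} {r : L.Rid} {x : S.Range (L.attr r)} :
    (L.possF r x).Sat I ↔ Sum.inr (AuxAtom.poss r ⟨L.ruleAtom r x, rfl⟩) ∈ I := Iff.rfl

theorem sat_and {α : Type u} {I : Set α} {F G : Formula α} :
    (F.and G).Sat I ↔ F.Sat I ∧ G.Sat I := Iff.rfl

theorem aux_inj {x y : L.AuxAtom} : L.aux x = L.aux y ↔ x = y :=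
  ⟨fun h => Sum.inr.inj (Formula.atom.inj h), fun h => h ▸ rfl⟩

theorem aux_ne_bot {x : L.AuxAtom} : L.aux x ≠ .bot := nofun

theorem level_lt_of_atomsIn {x : L.AuxAtom} {n : ℕ} (h : L.level x < n) :
    (L.aux x).AtomsIn {z | ∀ y, z = Sum.inr y → L.level y < n} := by
  rintro y hy
  cases hy
  exact h

theorem atomsIn_base {F : Formula (BaseAtom S)} {n : ℕ} :
    (L.base F).AtomsIn {z | ∀ y, z = Sum.inr y → L.level y < n} :=
  atomsIn_map (fun a y h => by cases h) F

theorem isLayeredRule_auxHard : ∀ F ∈ L.auxHard, IsLayeredRule L.level F := by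
  intro F hF
  simp only [auxHard, Finset.mem_union, mem_family] at hF
  rcases hF with ((((((((⟨t, rfl⟩ | ⟨e, rfl⟩) | ⟨e, rfl⟩) | ⟨e, rfl⟩) | ⟨e, rfl⟩) | ⟨t, rfl⟩) |
    ⟨t, rfl⟩) | ⟨t, rfl⟩) | ⟨t, rfl⟩) | ⟨t, rfl⟩
  · exact Or.inr ⟨_, _, rfl, atomsIn_base, atomsIn_base, atomsIn_base, trivial⟩
  · exact Or.inr ⟨_, _, rfl, level_lt_of_atomsIn (by simp [level]), atomsIn_base⟩
  · exact Or.inr ⟨_, _, rfl, atomsIn_base, level_lt_of_atomsIn (by simp [level])⟩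
  · exact Or.inl ⟨_, rfl⟩
  · exact Or.inr ⟨_, _, rfl, level_lt_of_atomsIn (by simp [level])⟩
  · exact Or.inr ⟨_, _, rfl, level_lt_of_atomsIn (by simp [level]),
      level_lt_of_atomsIn (by simp [level]), trivial⟩
  · exact Or.inr ⟨_, _, rfl, atomsIn_base, level_lt_of_atomsIn (by simp [level]),
      atomsIn_sumEq fun _ => level_lt_of_atomsIn (by simp [level])⟩
  · exact Or.inr ⟨_, _, rfl, atomsIn_base, atomsIn_base, level_lt_of_atomsIn (by simp [level]),
      atomsIn_sumEq fun _ => level_lt_of_atomsIn (by simp [level])⟩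
  · exact Or.inr ⟨_, _, rfl, level_lt_of_atomsIn (by simp [level])⟩
  · exact Or.inl ⟨_, rfl⟩

/-- The `#sum` aggregate is indexed by a subtype of the pr-atoms of `r`, whereas `RemHolds` sums
over a filtered finset; this identifies the two. -/
theorem sum_applied (W : Set (BaseAtom S)) (r : L.Rid) (p : {e // e ∈ L.P} → Prop)
    (hp : ∀ e, p e ↔ L.Applied W e.1) :
    ∑ e ∈ (Set.toFinite {e : {e : {e // e ∈ L.P} // e.1.rid = r} | p e.1}).toFinset, e.1.1.prob =
      ∑ e ∈ L.P with e.rid = r ∧ L.Applied W e, e.prob := by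
  refine Finset.sum_bij (fun e _ => e.1.1) ?_ ?_ ?_ ?_
  · rintro ⟨⟨e, he⟩, hr⟩ h
    simp only [Set.Finite.mem_toFinset, Set.mem_ofPred_eq, hp] at h
    exact Finset.mem_filter.2 ⟨he, hr, h⟩
  · rintro ⟨⟨e, he⟩, hr⟩ _ ⟨⟨e', he'⟩, hr'⟩ _ h
    simpa using h
  · intro e he
    obtain ⟨he, hr, ha⟩ := Finset.mem_filter.1 he
    exact ⟨⟨⟨e, he⟩, hr⟩, by simpa [hp] using ha, rfl⟩
  · intros
    rfl

/-- The auxiliary atoms satisfy the completion of the rules of the translation if and only if they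
have the truth values `AuxHolds`. -/
theorem exists_rule_iff {I : Set L.MAtom} (x : L.AuxAtom)
    (h : ∀ y, L.level y < L.level x → (Sum.inr y ∈ I ↔ L.AuxHolds (restrict I) y)) :
    (∃ B : Formula L.MAtom, B.imp (L.aux x) ∈ L.auxHard ∧ B.Sat I) ↔ L.AuxHolds (restrict I) x := by
  constructor
  · rintro ⟨B, hB, hs⟩
    -- The head of the rule is an atom, so the two families of constraints drop out and eight
    -- families remain.
    simp only [auxHard, Finset.mem_union, mem_family, imp.injEq, possF, aux_inj, aux_ne_bot.symm,
      and_false, exists_false, or_false] at hB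
    rcases hB with (((((((⟨⟨r, y⟩, rfl, rfl⟩ | ⟨e, rfl, rfl⟩) | ⟨e, rfl, rfl⟩) | ⟨e, rfl, rfl⟩) |
      ⟨⟨r, y⟩, rfl, rfl⟩) | ⟨⟨r, y, m⟩, rfl, rfl⟩) | ⟨⟨r, y, k⟩, rfl, rfl⟩) | ⟨⟨r, k⟩, rfl, rfl⟩)
    · simp only [sat_and, sat_base, sat_neg] at hs
      exact ⟨rfl, hs⟩
    · simp only [sat_and, sat_base, sat_aux] at hs
      rw [h _ (by simp [level])] at hs
      exact hs
    · simp only [sat_and, sat_base, sat_aux] at hs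
      rw [h _ (by simp [level])] at hs
      exact hs
    · simp only [sat_aux] at hs
      rw [h _ (by simp [level])] at hs
      exact ⟨e.1, e.2, rfl, hs⟩
    · simp only [sat_and, sat_neg, sat_aux] at hs
      rw [h _ (by simp [level]), h _ (by simp [level])] at hs
      exact ⟨⟨r, hs.1⟩, hs.2⟩
    · simp only [sat_and, sat_base, sat_aux, sat_countEq] at hs
      have h' : ∀ y, _ := fun y => h (.possWithDefPr (L.ruleRAtom r y)) (by simp [level])
      simp only [h'] at hs
      exact ⟨⟨y, hs.1, hs.2.1⟩, hs.2.2⟩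
    · simp only [sat_and, sat_base, sat_aux, sat_sumEq] at hs
      rw [h (.possWithDefPr _) (by simp [level]), sum_applied (restrict I) r.1
        (fun e => Sum.inr (.possWithAssPrOf (L.keyOf e)) ∈ I)
        (fun e => h (.possWithAssPrOf (L.keyOf e)) (by simp [level]))] at hs
      exact ⟨r.1, rfl, r.2, hs.1, ⟨y, hs.2.1, hs.2.2.1⟩, hs.2.2.2⟩
    · simp only [sat_aux] at hs
      rw [h _ (by simp [level])] at hs
      exact hs
  · intro hx
    simp only [auxHard, Finset.mem_union, mem_family]
    cases x with
    | poss r A =>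
      obtain ⟨⟨a, y⟩, hA⟩ := A
      dsimp only at hA
      subst hA
      refine ⟨_, .inl (.inl (.inl (.inl (.inl (.inl (.inl (.inl (.inl ⟨⟨r, y⟩, rfl⟩)))))))), ?_⟩
      simp only [sat_and, sat_base, sat_neg]
      exact hx.2
    | possWithAssPrOf k =>
      obtain ⟨k, hk⟩ := k
      -- The rule does not mention the probability, so any pr-atom with this triple supplies it.
      obtain ⟨e, he, rfl⟩ := Finset.mem_image.1 hk
      refine ⟨_, .inl (.inl (.inl (.inl (.inl (.inl (.inl (.inl (.inr ⟨⟨e, he⟩, rfl⟩)))))))), ?_⟩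
      simp only [sat_and, sat_base, sat_aux]
      rw [h _ (by simp [level])]
      exact hx
    | assPr k =>
      obtain ⟨k, hk⟩ := k
      obtain ⟨e, he, rfl⟩ := Finset.mem_image.1 hk
      refine ⟨_, .inl (.inl (.inl (.inl (.inl (.inl (.inl (.inr ⟨⟨e, he⟩, rfl⟩))))))), ?_⟩
      simp only [sat_and, sat_base, sat_aux]
      rw [h _ (by simp [level])]
      exact hx
    | possWithAssPr A =>
      obtain ⟨e, he, hA, ha⟩ := hx
      obtain ⟨A, hr⟩ := A
      obtain rfl : e.atom = A := hA
      refine ⟨_, .inl (.inl (.inl (.inl (.inl (.inr ⟨⟨e, he⟩, rfl⟩))))), ?_⟩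
      simp only [sat_aux]
      rw [h _ (by simp [level])]
      exact ha
    | possWithDefPr A =>
      obtain ⟨⟨r, hr⟩, hn⟩ := hx
      obtain ⟨⟨a, y⟩, hA⟩ := A
      obtain rfl : a = L.attr r := hr.1
      refine ⟨_, .inl (.inl (.inl (.inl (.inr ⟨⟨r, y⟩, rfl⟩)))), ?_⟩
      simp only [sat_and, sat_neg, sat_aux, sat_possF]
      rw [h _ (by simp [level]), h _ (by simp [level])]
      exact ⟨hr, hn⟩
    | numDefPr a m =>
      obtain ⟨a, r, rfl⟩ := a
      obtain ⟨⟨y, hy, hd⟩, hm⟩ := hx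
      refine ⟨_, .inl (.inl (.inl (.inr ⟨⟨r, y, m⟩, rfl⟩))), ?_⟩
      simp only [sat_and, sat_base, sat_aux, sat_countEq]
      have h' : ∀ y, _ := fun y => h (.possWithDefPr (L.ruleRAtom r y)) (by simp [level])
      simp only [h']
      exact ⟨hy, hd, hm⟩
    | remPr a k =>
      obtain ⟨a, r', hr'⟩ := a
      -- The supporting rule belongs to the `r` given by `RemHolds`, whose body is true; the `r'` of
      -- the index only shows that `a` has some random selection rule.
      obtain ⟨r, rfl, hr, hb, ⟨y, hy, hd⟩, hk⟩ := hx
      refine ⟨_, .inl (.inl (.inr ⟨⟨⟨r, hr⟩, y, k⟩, rfl⟩)), ?_⟩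
      simp only [sat_and, sat_base, sat_aux, sat_sumEq]
      rw [h (.possWithDefPr _) (by simp [level]), sum_applied (restrict I) r
        (fun e => Sum.inr (.possWithAssPrOf (L.keyOf e)) ∈ I)
        (fun e => h (.possWithAssPrOf (L.keyOf e)) (by simp [level]))]
      exact ⟨hb, hy, hd, hk⟩
    | totalDefPr a k =>
      obtain ⟨a, r', hr'⟩ := a
      obtain ⟨r, rfl, hr, hx⟩ := id hx
      refine ⟨_, .inl (.inr ⟨⟨⟨r, hr⟩, k⟩, rfl⟩), ?_⟩
      simp only [sat_aux]
      rw [h _ (by simp [level])]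
      exact ⟨r, rfl, hr, hx⟩

end PLog

/-! ### Stable models of the hard rules -/

namespace PLog

variable {S : Sig.{u, v}} {L : PLog.{u, v, w} S}

variable (L) in
/-- The hard rules of the translation. -/
def hardRules : Finset (Formula L.MAtom) := L.tau.image L.base ∪ L.auxHard

theorem plog2lpmln_eq : L.plog2lpmln = (L.hardRules.image fun F => (Weight.hard, F)) ∪
    L.auxSoft.image fun x => (Weight.soft x.1, x.2) := by
  rw [hardRules, Finset.image_union, Finset.image_image]
  rfl

/-- The signature contains `RemPr(a, k)` only for `k` in the finite set `pRem a`; this guarantees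
that the atom needed for the actual remaining mass exists. -/
theorem RemHolds.mem_pRem {W : Set (BaseAtom S)} {a : S.Attr} {k : ℝ} (h : L.RemHolds W a k) :
    k ∈ L.pRem a := by
  obtain ⟨r, rfl, -, -, -, hk⟩ := h
  refine Finset.mem_image.2 ⟨_, Finset.mem_powerset.2 fun e he => ?_, by rw [hk]; ring⟩
  simp only [Finset.mem_filter] at he ⊢
  exact ⟨he.1, by rw [e.attr_eq, he.2.1]⟩

variable (L) in
/-- The extension of `W` satisfies the constraints of the translation. -/
def Admissible (W : Set (BaseAtom S)) : Prop :=
  (∀ e ∈ L.P, BaseAtom.val e.atom ∈ W → L.Applied W e → e.prob ≠ 0) ∧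
    ∀ a k, L.RemHolds W a k → 0 < k

/-- Being a model gives one direction of the completion, being supported the other. Together they
determine the auxiliary atoms level by level, and only the constraints are left as conditions on the
original atoms. -/
theorem sat_auxHard_and_supported_iff {I : Set L.MAtom} :
    ((∀ F ∈ L.auxHard, F.Sat I) ∧
      ∀ x, Sum.inr x ∈ I → ∃ B, imp B (atom (Sum.inr x)) ∈ L.auxHard ∧ B.Sat I) ↔
      I = L.extend (restrict I) ∧ L.Admissible (restrict I) := by
  constructor
  · rintro ⟨hm, hs⟩
    have key : ∀ n x, L.level x = n → (Sum.inr x ∈ I ↔ L.AuxHolds (restrict I) x) := by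
      intro n
      induction n using Nat.strong_induction_on with
      | _ n ih =>
      intro x hx
      rw [← exists_rule_iff x fun y hy => ih _ (hx ▸ hy) y rfl]
      exact ⟨hs x, fun ⟨B, hB, h⟩ => hm _ hB h⟩
    refine ⟨?_, fun e he hv ha h0 => ?_, fun a k hk => ?_⟩
    · ext (z | x)
      · rfl
      · exact key _ x rfl
    · refine hm ((L.aux (.assPr (L.keyOf ⟨e, he⟩))).imp .bot) ?_ ((key _ _ rfl).2 ⟨hv, ha⟩)
      simp only [auxHard, Finset.mem_union, mem_family]
      exact .inl (.inl (.inl (.inl (.inl (.inl (.inr ⟨⟨⟨e, he⟩, h0⟩, rfl⟩))))))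
    · by_contra h0
      obtain ⟨r, rfl, hr, -⟩ := id hk
      refine hm ((L.aux (.remPr (L.ruleRAttr r) ⟨k, hk.mem_pRem⟩)).imp .bot) ?_
        ((key _ _ rfl).2 hk)
      simp only [auxHard, Finset.mem_union, mem_family]
      exact .inr ⟨⟨⟨r, hr⟩, ⟨k, hk.mem_pRem⟩, not_lt.1 h0⟩, rfl⟩
  · rintro ⟨hI, hadm⟩
    have key : ∀ x, Sum.inr x ∈ I ↔ L.AuxHolds (restrict I) x := by
      intro x
      conv_lhs => rw [hI]
      exact inr_mem_extend
    refine ⟨fun F hF => ?_, fun x hx => ?_⟩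
    · rcases isLayeredRule_auxHard F hF with ⟨B, rfl⟩ | ⟨B, x, rfl, -⟩
      -- Only two families have head `⊥`: `AssPr` with probability 0 and `RemPr` with `k ≤ 0`.
      · simp only [auxHard, Finset.mem_union, mem_family, imp.injEq, aux_ne_bot, possF,
          and_false, exists_false, or_false, false_or, and_true] at hF
        rcases hF with ⟨e, rfl⟩ | ⟨⟨r, k⟩, rfl⟩
        · intro h
          obtain ⟨hv, ha⟩ := (key _).1 h
          exact hadm.1 e.1.1 e.1.2 hv ha e.2
        · intro h
          exact absurd (hadm.2 _ _ ((key _).1 h)) (not_lt.2 k.2)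
      · exact fun h => (key x).2 ((exists_rule_iff x fun y _ => key y).1 ⟨B, hF, h⟩)
    · exact (exists_rule_iff x fun y _ => key y).2 ((key x).1 hx)

theorem isStableModel_hardRules_iff {I : Set L.MAtom} :
    IsStableModel {F | F ∈ L.hardRules} I ↔
      restrict I ∈ L.worlds ∧ I = L.extend (restrict I) ∧ L.Admissible (restrict I) := by
  have : {F | F ∈ L.hardRules} = map Sum.inl '' {F | F ∈ L.tau} ∪ {F | F ∈ L.auxHard} := by
    ext F
    simp [hardRules, base]
  rw [this, isStableModel_union_layered (Δ := {F | F ∈ L.auxHard}) isLayeredRule_auxHard, ← sat_auxHard_and_supported_iff]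
  rfl

theorem mem_hardSM_plog2lpmln {I : Set L.MAtom} : I ∈ L.plog2lpmln.hardSM ↔
      restrict I ∈ L.worlds ∧ I = L.extend (restrict I) ∧ L.Admissible (restrict I) := by
  rw [plog2lpmln_eq, LPMLN.mem_hardSM_iff, isStableModel_hardRules_iff]
  intro x hx
  simp only [auxSoft, Finset.mem_union, mem_family] at hx
  rcases hx with (⟨e, rfl⟩ | ⟨t, rfl⟩) | ⟨t, rfl⟩ <;> exact ⟨_, rfl⟩

/-! ### Probabilities of atoms in possible worlds -/

variable {W : Set (BaseAtom S)}

theorem value_unique (hW : W ∈ L.worlds) {A B : S.Atom} (hA : BaseAtom.val A ∈ W)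
    (hB : BaseAtom.val B ∈ W) (h : A.1 = B.1) : A = B := by
  obtain ⟨a, x⟩ := A
  obtain ⟨b, y⟩ := B
  obtain rfl : a = b := h
  by_contra hne
  have hxy : x ≠ y := fun h => hne (h ▸ rfl)
  refine (isStableModel_iff.1 hW).1 (((valF ⟨a, x⟩).and (valF ⟨a, y⟩)).imp .bot) ?_ ⟨hA, hB⟩
  simp only [tau, Finset.mem_union, mem_family, Set.mem_ofPred_eq]
  exact .inl (.inl (.inl (.inl (.inl (.inl (.inl (.inl (.inl (.inr ⟨⟨a, (x, y), hxy⟩, rfl⟩)))))))))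

theorem rule_unique (hrule : L.UniqueRule) (hW : W ∈ L.worlds) {r s : L.Rid}
    (hr : (bodyF (L.rule r).body).Sat W) (hs : (bodyF (L.rule s).body).Sat W)
    (h : L.attr r = L.attr s) : r = s :=
  by_contra fun hne => hrule r s hne h W hW ⟨hr, hs⟩

/-- `UniqueAssignment` compares pr-atoms of a single rule only. Both rule bodies hold in `W`, so
`UniqueRule` first forces the rules to coincide. -/
theorem applied_unique (hrule : L.UniqueRule) (hassign : L.UniqueAssignment) (hW : W ∈ L.worlds)
    {e f : PrAtom L.rule} (he : e ∈ L.P) (hf : f ∈ L.P) (hae : L.Applied W e)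
    (haf : L.Applied W f) (h : e.atom = f.atom) : e = f := by
  by_contra hne
  have hr := rule_unique hrule hW hae.1.2.1 haf.1.2.1 (by
    show (L.rule e.rid).attr = (L.rule f.rid).attr
    rw [← e.attr_eq, ← f.attr_eq, h])
  exact hassign e he f hf hne hr h W hW ⟨hae.1.2.1, hae.2, haf.2⟩

theorem possWithAssPr_eq (hrule : L.UniqueRule) (hassign : L.UniqueAssignment)
    (hW : W ∈ L.worlds) {e : PrAtom L.rule} (he : e ∈ L.P) (hae : L.Applied W e) :
    L.possWithAssPr W e.atom = e.prob := by
  have h : ∃ f, f ∈ L.P ∧ f.atom = e.atom ∧ L.Applied W f := ⟨e, he, rfl, hae⟩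
  have hs := Classical.choose_spec h
  rw [possWithAssPr, dif_pos h, applied_unique hrule hassign hW hs.1 he hs.2.2 hae hs.2.1]

theorem atomProb_applied (hrule : L.UniqueRule) (hassign : L.UniqueAssignment)
    (hW : W ∈ L.worlds) {e : PrAtom L.rule} (he : e ∈ L.P) (hae : L.Applied W e) :
    L.atomProb W e.atom = e.prob := by
  rw [atomProb, if_pos ⟨e, he, rfl, hae⟩, possWithAssPr_eq hrule hassign hW he hae]

variable (L) in
/-- The sum of the probabilities assigned by the pr-atoms of `r` that are applied in `W`. -/
def assigned (W : Set (BaseAtom S)) (r : L.Rid) : ℝ :=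
  ∑ e ∈ L.P with e.rid = r ∧ L.Applied W e, e.prob

variable (L) in
/-- The number of the values of `a` that have the default probability. -/
def defCount (W : Set (BaseAtom S)) (a : S.Attr) : ℕ :=
  {x : S.Range a | L.DefaultPossible W ⟨a, x⟩}.ncard

/-- Reconciles the sum over values in P-log with the sum over pr-atoms in the aggregate. Sending an
applied pr-atom of `r` to its value is injective by `applied_unique`. It reaches all of `AV`,
because every applied pr-atom for this attribute belongs to `r`, the only rule for it with a true
body. -/
theorem sum_AV (hrule : L.UniqueRule) (hassign : L.UniqueAssignment)
    (hW : W ∈ L.worlds) {r : L.Rid} (hr : (bodyF (L.rule r).body).Sat W) :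
    ∑ x ∈ (Set.toFinite (L.AV W (L.attr r))).toFinset, L.possWithAssPr W ⟨L.attr r, x⟩ =
      L.assigned W r := by
  have hmem : ∀ x, x ∈ L.AV W (L.attr r) ↔
      ∃ e ∈ L.P, e.atom = ⟨L.attr r, x⟩ ∧ L.Applied W e := fun x => Iff.rfl
  have hatom : ∀ e ∈ L.P, e.rid = r → ∃ x, e.atom = ⟨L.attr r, x⟩ := by
    rintro ⟨_, ⟨a, x⟩, ha, -, -, -, -⟩ - rfl
    obtain rfl : a = _ := ha
    exact ⟨x, rfl⟩
  symm
  refine Finset.sum_bij' (fun e he => (hatom e (Finset.mem_filter.1 he).1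
    (Finset.mem_filter.1 he).2.1).choose)
    (fun x hx => ((hmem x).1 ((Set.Finite.mem_toFinset _).1 hx)).choose) ?_ ?_ ?_ ?_ ?_
  · intro e he
    rw [Set.Finite.mem_toFinset]
    obtain ⟨he, hr, ha⟩ := Finset.mem_filter.1 he
    exact ⟨e, he, (hatom e he hr).choose_spec, ha⟩
  · intro x hx
    obtain ⟨he, hx, ha⟩ := ((hmem x).1 ((Set.Finite.mem_toFinset _).1 hx)).choose_spec
    refine Finset.mem_filter.2 ⟨he, rule_unique hrule hW ha.1.2.1 hr ?_, ha⟩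
    rw [attr, ← PrAtom.attr_eq, hx]
  · intro e he
    obtain ⟨he, hr, ha⟩ := Finset.mem_filter.1 he
    generalize_proofs h1 h2
    exact applied_unique hrule hassign hW h2.choose_spec.1 he h2.choose_spec.2.2 ha
      (h2.choose_spec.2.1.trans h1.choose_spec.symm)
  · intro x hx
    generalize_proofs h1 h2
    have := h2.choose_spec.symm.trans h1.choose_spec.2.1
    simpa using this
  · intro e he
    obtain ⟨he, hr, ha⟩ := Finset.mem_filter.1 he
    generalize_proofs h1
    rw [← h1.choose_spec, possWithAssPr_eq hrule hassign hW he ha]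

theorem atomProb_default (hrule : L.UniqueRule) (hassign : L.UniqueAssignment)
    (hW : W ∈ L.worlds) {r : L.Rid} (hr : (bodyF (L.rule r).body).Sat W) {x : S.Range (L.attr r)}
    (hx : x ∉ L.AV W (L.attr r)) :
    L.atomProb W ⟨L.attr r, x⟩ =
      max ((1 - L.assigned W r) / (L.defCount W (L.attr r) : ℝ)) 0 := by
  rw [atomProb, if_neg hx, possWithDefPr, sum_AV hrule hassign hW hr]
  rfl

theorem defCount_pos {a : S.Attr} {x : S.Range a} (hx : L.DefaultPossible W ⟨a, x⟩) :
    0 < L.defCount W a :=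
  (Set.ncard_pos (Set.toFinite _)).2 ⟨x, hx⟩

theorem defCount_le {a : S.Attr} : L.defCount W a ≤ (S.range a.1).card := by
  refine (Set.ncard_le_ncard (Set.subset_univ _) (Set.toFinite _)).trans ?_
  rw [Set.ncard_univ, Nat.card_eq_fintype_card, Fintype.card_coe]

/-- Rule uniqueness leaves one candidate for the remaining mass. The existence of a pr-atom stays as
a condition because rules without pr-atoms have no `RemPr` rule. -/
theorem remHolds_iff (hrule : L.UniqueRule) (hW : W ∈ L.worlds) {r : L.Rid}
    (hr : (bodyF (L.rule r).body).Sat W) {x : S.Range (L.attr r)}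
    (hv : BaseAtom.val ⟨L.attr r, x⟩ ∈ W) (hx : L.DefaultPossible W ⟨L.attr r, x⟩) {k : ℝ} :
    L.RemHolds W (L.attr r) k ↔ (∃ e ∈ L.P, e.rid = r) ∧ k = 1 - L.assigned W r := by
  constructor
  · rintro ⟨s, hs, he, hb, -, hk⟩
    obtain rfl := rule_unique hrule hW hb hr hs
    exact ⟨he, by rw [assigned, hk]; ring⟩
  · rintro ⟨he, rfl⟩
    exact ⟨r, rfl, he, hr, ⟨x, hv, hx⟩, by rw [assigned]; ring⟩

theorem assigned_eq_zero {r : L.Rid} (h : ¬ ∃ e ∈ L.P, e.rid = r) : L.assigned W r = 0 :=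
  Finset.sum_eq_zero fun e he =>
    absurd ⟨e, (Finset.mem_filter.1 he).1, (Finset.mem_filter.1 he).2.1⟩ h

/-- A rule with pr-atoms is covered by the constraint on `RemPr`; for a rule without any, the whole
mass 1 remains. -/
theorem Admissible.assigned_lt_one (hadm : L.Admissible W) (hrule : L.UniqueRule)
    (hW : W ∈ L.worlds) {r : L.Rid} (hr : (bodyF (L.rule r).body).Sat W) {x : S.Range (L.attr r)}
    (hv : BaseAtom.val ⟨L.attr r, x⟩ ∈ W) (hx : L.DefaultPossible W ⟨L.attr r, x⟩) :
    0 < 1 - L.assigned W r := by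
  by_cases he : ∃ e ∈ L.P, e.rid = r
  · exact hadm.2 _ _ ((remHolds_iff hrule hW hr hv hx).2 ⟨he, rfl⟩)
  · rw [assigned_eq_zero he]
    norm_num

theorem atomProb_nonneg (A : S.Atom) : 0 ≤ L.atomProb W A := by
  rw [atomProb, possWithAssPr, possWithDefPr]
  split_ifs
  · exact PrAtom.prob_nonneg _
  · exact le_rfl
  · exact le_max_right _ _

theorem muHat_nonneg : 0 ≤ L.muHat W := Finset.prod_nonneg fun A _ => atomProb_nonneg A

/-- A product vanishes exactly if a factor does. An assigned factor is the number `q`. A default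
factor is the remaining mass over a positive count, truncated at 0, so it vanishes exactly when that
mass is not positive. -/
theorem admissible_iff (hrule : L.UniqueRule) (hassign : L.UniqueAssignment)
    (hW : W ∈ L.worlds) : L.Admissible W ↔ L.muHat W ≠ 0 := by
  rw [muHat, Finset.prod_ne_zero_iff]
  simp only [Set.Finite.mem_toFinset, Set.mem_ofPred_eq]
  constructor
  · rintro hadm ⟨a, x⟩ ⟨hv, hp⟩
    by_cases hx : x ∈ L.AV W a
    · obtain ⟨e, he, h, ha⟩ := hx
      rw [← h] at hv ⊢
      rw [atomProb_applied hrule hassign hW he ha]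
      exact hadm.1 e he hv ha
    · obtain ⟨r, hr⟩ := id hp
      obtain rfl : a = L.attr r := hr.1
      rw [atomProb_default hrule hassign hW hr.2.1 hx]
      have h1 := hadm.assigned_lt_one hrule hW hr.2.1 hv ⟨hp, hx⟩
      have h2 := defCount_pos (L := L) ⟨hp, hx⟩
      exact (lt_max_of_lt_left (div_pos h1 (by exact_mod_cast h2))).ne'
  · intro h
    refine ⟨fun e he hv ha => ?_, fun a k hk => ?_⟩
    · rw [← atomProb_applied hrule hassign hW he ha]
      exact h _ ⟨hv, e.rid, ha.1⟩
    · obtain ⟨r, rfl, -, hr, ⟨x, hv, hx⟩, -⟩ := id hk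
      have h1 := h _ ⟨hv, hx.1⟩
      rw [atomProb_default hrule hassign hW hr hx.2,
        ← ((remHolds_iff hrule hW hr hv hx).1 hk).2] at h1
      by_contra hk0
      exact h1 (max_eq_right (div_nonpos_of_nonpos_of_nonneg (not_lt.1 hk0) (Nat.cast_nonneg _)))

end PLog

namespace PLog

variable {S : Sig.{u, v}} {L : PLog.{u, v, w} S} {W : Set (BaseAtom S)}

/-! ### The soft rules -/

variable (L) in
/-- The soft rule `⊥ ← not x`. -/
def softF (x : L.AuxAtom) : Formula L.MAtom := (L.aux x).neg.imp .bot

variable (L) in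
/-- The attribute of an auxiliary atom. -/
def subject : L.AuxAtom → S.Attr
  | .poss r _ => L.attr r
  | .possWithAssPrOf k => k.1.2.2.1
  | .assPr k => k.1.2.2.1
  | .possWithAssPr A => A.1.1
  | .possWithDefPr A => A.1.1
  | .numDefPr a _ => a.1
  | .remPr a _ => a.1
  | .totalDefPr a _ => a.1

theorem softF_inj {x y : L.AuxAtom} : L.softF x = L.softF y ↔ x = y :=
  ⟨fun h => by simpa [softF, neg, aux_inj] using h, fun h => h ▸ rfl⟩

theorem sat_softF {x : L.AuxAtom} : (L.softF x).Sat (L.extend W) ↔ L.AuxHolds W x :=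
  not_not

variable (L) in
/-- The soft rules about the attribute `a` that the extension of `W` satisfies. -/
def softAt (W : Set (BaseAtom S)) (a : S.Attr) : Finset (ℝ × Formula L.MAtom) :=
  {y ∈ L.auxSoft | y.2.Sat (L.extend W) ∧ ∃ x, y.2 = L.softF x ∧ L.subject x = a}

theorem mem_softAt {a : S.Attr} {y : ℝ × Formula L.MAtom} :
    y ∈ L.softAt W a ↔ y ∈ L.auxSoft ∧ y.2.Sat (L.extend W) ∧
      ∃ x, y.2 = L.softF x ∧ L.subject x = a := by
  rw [softAt, Finset.mem_filter]

theorem mem_auxSoft {y : ℝ × Formula L.MAtom} : y ∈ L.auxSoft ↔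
    (∃ e : {e // e ∈ L.P}, 0 < e.1.prob ∧
      y = (Real.log e.1.prob, L.softF (.assPr (L.keyOf e)))) ∨
    (∃ (r : L.Rid) (m : {m : ℕ // m ∈ Finset.Icc 1 (S.range (L.attr r).1).card}), 2 ≤ m.1 ∧
      y = (Real.log (1 / (m.1 : ℝ)), L.softF (.numDefPr (L.ruleRAttr r) m))) ∨
    ∃ (r : L.RidWithPr) (k : {k : ℝ // k ∈ (L.pRem (L.attr r.1)).filter fun k => 0 < k}),
      y = (Real.log k.1, L.softF (.totalDefPr (L.ruleRAttr r.1) k)) := by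
  simp only [auxSoft, Finset.mem_union, mem_family, or_assoc]
  refine or_congr ⟨?_, ?_⟩ (or_congr ⟨?_, ?_⟩ ⟨?_, ?_⟩)
  · rintro ⟨⟨e, h⟩, rfl⟩
    exact ⟨e, h, rfl⟩
  · rintro ⟨e, h, rfl⟩
    exact ⟨⟨e, h⟩, rfl⟩
  · rintro ⟨⟨r, m, h⟩, rfl⟩
    exact ⟨r, m, h, rfl⟩
  · rintro ⟨r, m, h, rfl⟩
    exact ⟨⟨r, m, h⟩, rfl⟩
  · rintro ⟨⟨r, k⟩, rfl⟩
    exact ⟨r, k, rfl⟩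
  · rintro ⟨r, k, rfl⟩
    exact ⟨⟨r, k⟩, rfl⟩

/-- Soft rules are indexed by random selection rules, several of which may share an attribute, and
the type of `m` depends on the attribute. Hence equal attributes have to be transported. -/
theorem numDefPr_congr {a b : L.RAttr} (h : a = b)
    {m : {m : ℕ // m ∈ Finset.Icc 1 (S.range a.1.1).card}}
    {n : {m : ℕ // m ∈ Finset.Icc 1 (S.range b.1.1).card}} (hm : m.1 = n.1) :
    (AuxAtom.numDefPr a m : L.AuxAtom) = .numDefPr b n := by
  subst h
  rw [Subtype.ext hm]

theorem totalDefPr_congr {a b : L.RAttr} (h : a = b)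
    {k : {k : ℝ // k ∈ (L.pRem a.1).filter fun k => 0 < k}}
    {l : {k : ℝ // k ∈ (L.pRem b.1).filter fun k => 0 < k}} (hk : k.1 = l.1) :
    (AuxAtom.totalDefPr a k : L.AuxAtom) = .totalDefPr b l := by
  subst h
  rw [Subtype.ext hk]

/-- The attribute has only one value in `W`, and that value has an assigned probability. So
`NumDefPr` and `TotalDefPr` are false for it, and by `applied_unique` `e` is the only pr-atom whose
`AssPr` is true. -/
theorem softAt_applied (hrule : L.UniqueRule) (hassign : L.UniqueAssignment)
    (hW : W ∈ L.worlds) {e : PrAtom L.rule} (he : e ∈ L.P) (hae : L.Applied W e)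
    (hv : BaseAtom.val e.atom ∈ W) (hpos : 0 < e.prob) :
    L.softAt W e.atom.1 = {(Real.log e.prob, L.softF (.assPr (L.keyOf ⟨e, he⟩)))} := by
  have hdef : ∀ a, a = e.atom.1 → ¬ ∃ x, BaseAtom.val ⟨a, x⟩ ∈ W ∧ L.DefaultPossible W ⟨a, x⟩ := by
    rintro a ha ⟨x, hx, hd⟩
    have := value_unique hW hx hv ha
    rw [this] at hd
    exact hd.2 ⟨e, he, rfl, hae⟩
  ext y
  rw [mem_softAt, mem_auxSoft, Finset.mem_singleton]
  constructor
  · rintro ⟨⟨f, -, rfl⟩ | ⟨r, m, -, rfl⟩ | ⟨r, k, rfl⟩, hs, x, hx, ha⟩ <;>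
      rw [softF_inj] at hx <;> subst hx <;> rw [sat_softF] at hs
    · have h : f.1 = e := applied_unique hrule hassign hW f.2 he hs.2 hae
        (value_unique hW hs.1 hv ha)
      obtain ⟨f, hf⟩ := f
      obtain rfl : f = e := h
      rfl
    · exact absurd hs.1 (hdef _ ha)
    · obtain ⟨s, hs, -, -, hx, -⟩ := hs
      exact absurd hx (hdef _ ha)
  · rintro rfl
    exact ⟨Or.inl ⟨⟨e, he⟩, hpos, rfl⟩, sat_softF.2 ⟨hv, hae⟩, _, rfl, rfl⟩

/-- The true value has no applied pr-atom, so no `AssPr` about the attribute holds. At most two soft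
rules are satisfied, one for the count and one for the remaining mass. The first is missing if the
count is 1, the second if `r` has no pr-atoms; the corresponding logarithm is then `ln 1 = 0`. -/
theorem sum_softAt_default (hrule : L.UniqueRule)
    (hW : W ∈ L.worlds) {r : L.Rid} (hr : (bodyF (L.rule r).body).Sat W)
    {x : S.Range (L.attr r)} (hv : BaseAtom.val ⟨L.attr r, x⟩ ∈ W)
    (hx : L.DefaultPossible W ⟨L.attr r, x⟩) (hpos : 0 < 1 - L.assigned W r) :
    ∑ y ∈ L.softAt W (L.attr r), y.1 =
      Real.log (1 / (L.defCount W (L.attr r) : ℝ)) + Real.log (1 - L.assigned W r) := by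
  have hcount := defCount_pos hx
  have hmem : L.defCount W (L.attr r) ∈ Finset.Icc 1 (S.range (L.attr r).1).card :=
    Finset.mem_Icc.2 ⟨hcount, defCount_le⟩
  have hrem := fun k => remHolds_iff hrule hW hr hv hx (k := k)
  set num : Finset (ℝ × Formula L.MAtom) :=
    if 2 ≤ L.defCount W (L.attr r) then {(Real.log (1 / (L.defCount W (L.attr r) : ℝ)),
      L.softF (.numDefPr (L.ruleRAttr r) ⟨_, hmem⟩))} else ∅ with hnum
  set tot : Finset (ℝ × Formula L.MAtom) :=
    if h : ∃ e ∈ L.P, e.rid = r then {(Real.log (1 - L.assigned W r),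
      L.softF (.totalDefPr (L.ruleRAttr r) ⟨1 - L.assigned W r, Finset.mem_filter.2
        ⟨((hrem _).2 ⟨h, rfl⟩).mem_pRem, hpos⟩⟩))} else ∅ with htot
  have hunion : L.softAt W (L.attr r) = num ∪ tot := by
    ext y
    rw [mem_softAt, mem_auxSoft, Finset.mem_union]
    constructor
    · rintro ⟨⟨f, -, rfl⟩ | ⟨s, m, hm, rfl⟩ | ⟨s, k, rfl⟩, hs, x, hx, ha⟩ <;>
        rw [softF_inj] at hx <;> subst hx <;> rw [sat_softF] at hs
      · have := value_unique hW hs.1 hv ha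
        refine absurd ?_ hx.2
        exact ⟨f.1, f.2, this, hs.2⟩
      · left
        have ha' : L.ruleRAttr s = L.ruleRAttr r := Subtype.ext ha
        have hm' : m.1 = L.defCount W (L.attr r) := by
          rw [← show L.attr s = L.attr r from ha]
          exact hs.2.symm
        rw [hnum, if_pos (hm' ▸ hm), Finset.mem_singleton]
        exact Prod.ext (by simp only [hm']) (softF_inj.2 (numDefPr_congr ha' hm'))
      · right
        have ha' : L.ruleRAttr s.1 = L.ruleRAttr r := Subtype.ext ha
        have hs' : L.RemHolds W (L.attr r) k.1 := (show L.attr s.1 = L.attr r from ha) ▸ hs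
        have h := (hrem _).1 hs'
        rw [htot, dif_pos h.1, Finset.mem_singleton]
        exact Prod.ext (by simp only [h.2]) (softF_inj.2 (totalDefPr_congr ha' h.2))
    · rintro (hy | hy)
      · rw [hnum] at hy
        split_ifs at hy with h2
        · rw [Finset.mem_singleton] at hy
          subst hy
          exact ⟨Or.inr (Or.inl ⟨r, ⟨_, hmem⟩, h2, rfl⟩), sat_softF.2 ⟨⟨x, hv, hx⟩, rfl⟩, _, rfl, rfl⟩
        · simp at hy
      · rw [htot] at hy
        split_ifs at hy with he
        · rw [Finset.mem_singleton] at hy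
          subst hy
          exact ⟨Or.inr (Or.inr ⟨⟨r, he⟩, ⟨_, _⟩, rfl⟩), sat_softF.2 ((hrem _).2 ⟨he, rfl⟩),
            _, rfl, rfl⟩
        · simp at hy
  -- The two weights may be equal as real numbers, but the formulas differ.
  have hdisj : Disjoint num tot := by
    rw [Finset.disjoint_left]
    intro y h1 h2
    rw [hnum] at h1
    rw [htot] at h2
    split_ifs at h1 h2 <;> simp only [Finset.mem_singleton, Finset.notMem_empty] at h1 h2
    have := congrArg Prod.snd (h1.symm.trans h2)
    rw [softF_inj] at this
    cases this
  rw [hunion, Finset.sum_union hdisj]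
  congr 1
  · rw [hnum]
    split_ifs with h2
    · simp
    · have : L.defCount W (L.attr r) = 1 := by omega
      simp [this]
  · rw [htot]
    split_ifs with he
    · simp
    · simp [assigned_eq_zero he]

theorem exp_sum_softAt (hrule : L.UniqueRule) (hassign : L.UniqueAssignment)
    (hW : W ∈ L.worlds) (hadm : L.Admissible W) {A : S.Atom} (hv : BaseAtom.val A ∈ W)
    (hp : L.Possible W A) : Real.exp (∑ y ∈ L.softAt W A.1, y.1) = L.atomProb W A := by
  obtain ⟨a, x⟩ := A
  by_cases hx : x ∈ L.AV W a
  · obtain ⟨e, he, h, hae⟩ := hx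
    rw [← h] at hv ⊢
    have hpos : 0 < e.prob := lt_of_le_of_ne e.prob_nonneg (hadm.1 e he hv hae).symm
    rw [softAt_applied hrule hassign hW he hae hv hpos, Finset.sum_singleton, Real.exp_log hpos,
      atomProb_applied hrule hassign hW he hae]
  · obtain ⟨r, hr⟩ := id hp
    obtain rfl : a = L.attr r := hr.1
    have hpos := hadm.assigned_lt_one hrule hW hr.2.1 hv ⟨hp, hx⟩
    have hcount : (0 : ℝ) < L.defCount W (L.attr r) := by
      exact_mod_cast defCount_pos (L := L) ⟨hp, hx⟩
    rw [sum_softAt_default hrule hW hr.2.1 hv ⟨hp, hx⟩ hpos, Real.exp_add, Real.exp_log hpos,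
      Real.exp_log (by positivity), atomProb_default hrule hassign hW hr.2.1 hx,
      max_eq_left (by positivity)]
    ring

/-- The satisfied soft rules are partitioned by attribute, one block for each true possible atom,
and each block exponentiates to the probability of that atom. -/
theorem exp_softSum (hrule : L.UniqueRule) (hassign : L.UniqueAssignment)
    (hW : W ∈ L.worlds) (hadm : L.Admissible W) :
    Real.exp (L.plog2lpmln.softSum (L.extend W)) = L.muHat W := by
  have hmuHat : L.muHat W = ∏ A ∈ (Set.toFinite {A : S.Atom | BaseAtom.val A ∈ W ∧
      L.Possible W A}).toFinset, Real.exp (∑ y ∈ L.softAt W A.1, y.1) := by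
    refine Finset.prod_congr rfl fun A hA => ?_
    simp only [Set.Finite.mem_toFinset, Set.mem_ofPred_eq] at hA
    exact (exp_sum_softAt hrule hassign hW hadm hA.1 hA.2).symm
  rw [hmuHat, ← Real.exp_sum, plog2lpmln_eq, LPMLN.softSum_eq, ← Finset.sum_biUnion]
  · congr 1
    refine Finset.sum_congr ?_ fun _ _ => rfl
    ext y
    simp only [Finset.mem_filter, Finset.mem_biUnion, Set.Finite.mem_toFinset,
      Set.mem_ofPred_eq, mem_softAt]
    constructor
    · rintro ⟨hy, hs⟩
      -- No satisfied soft rule is lost: its auxiliary atom can only hold if some possible value of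
      -- its attribute is true in `W`.
      have key : ∀ x, y.2 = L.softF x → ∀ A : S.Atom, BaseAtom.val A ∈ W → L.Possible W A →
          L.subject x = A.1 → ∃ A : S.Atom, (BaseAtom.val A ∈ W ∧ L.Possible W A) ∧
            y ∈ L.auxSoft ∧ y.2.Sat (L.extend W) ∧ ∃ x, y.2 = L.softF x ∧ L.subject x = A.1 :=
        fun x hx A hv hp h => ⟨A, ⟨hv, hp⟩, hy, hs, x, hx, h⟩
      rcases mem_auxSoft.1 hy with ⟨e, -, h⟩ | ⟨r, m, -, h⟩ | ⟨r, k, h⟩ <;>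
        rw [h, sat_softF] at hs
      · exact key _ (by rw [h]) e.1.atom hs.1 ⟨e.1.rid, hs.2.1⟩ rfl
      · obtain ⟨x, hv, hx⟩ := hs.1
        exact key _ (by rw [h]) _ hv hx.1 rfl
      · obtain ⟨s, -, -, -, ⟨x, hv, hx⟩, -⟩ := hs
        exact key _ (by rw [h]) _ hv hx.1 rfl
    · rintro ⟨A, -, hy, hs, -⟩
      exact ⟨hy, hs⟩
  · intro A hA B hB hne
    simp only [Set.Finite.coe_toFinset, Set.mem_ofPred_eq] at hA hB
    rw [Function.onFun, Finset.disjoint_left]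
    intro y h1 h2
    obtain ⟨-, -, x, hx, hxA⟩ := mem_softAt.1 h1
    obtain ⟨-, -, z, hz, hzB⟩ := mem_softAt.1 h2
    -- A soft rule determines its auxiliary atom and hence its attribute, and `W` gives an attribute
    -- at most one value.
    obtain rfl : x = z := softF_inj.1 (hx.symm.trans hz)
    exact hne (value_unique hW hA.1 hB.1 (hxA.symm.trans hzB))

/-! ### The correspondence -/

theorem mem_hardSM_iff_muHat (hrule : L.UniqueRule) (hassign : L.UniqueAssignment)
    {I : Set L.MAtom} : I ∈ L.plog2lpmln.hardSM ↔
      restrict I ∈ L.worlds ∧ I = L.extend (restrict I) ∧ L.muHat (restrict I) ≠ 0 := by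
  rw [mem_hardSM_plog2lpmln]
  refine and_congr_right fun hW => and_congr_right fun _ => ?_
  exact admissible_iff hrule hassign hW

/-- Restriction and `extend` match the hard stable models with the worlds of nonzero weight; the
other worlds add nothing to the normalizing sum. -/
theorem sum_hardSM (hrule : L.UniqueRule) (hassign : L.UniqueAssignment) :
    ∑ J ∈ (Set.toFinite L.plog2lpmln.hardSM).toFinset, Real.exp (L.plog2lpmln.softSum J) =
      ∑ W ∈ (Set.toFinite L.worlds).toFinset, L.muHat W := by
  rw [← Finset.sum_filter_ne_zero (Set.toFinite L.worlds).toFinset]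
  refine Finset.sum_bij' (fun I _ => restrict I) (fun W _ => L.extend W) ?_ ?_ ?_ ?_ ?_
  · intro I hI
    rw [Set.Finite.mem_toFinset, mem_hardSM_iff_muHat hrule hassign] at hI
    simpa using ⟨hI.1, hI.2.2⟩
  · intro W hW
    rw [Set.Finite.mem_toFinset, mem_hardSM_iff_muHat hrule hassign]
    simpa [restrict_extend] using hW
  · intro I hI
    rw [Set.Finite.mem_toFinset, mem_hardSM_iff_muHat hrule hassign] at hI
    exact hI.2.1.symm
  · intro W hW
    rfl
  · intro I hI
    rw [Set.Finite.mem_toFinset, mem_hardSM_iff_muHat hrule hassign] at hI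
    rw [hI.2.1]
    exact exp_softSum hrule hassign hI.1 ((admissible_iff hrule hassign hI.1).2 hI.2.2)

theorem Consistent.sum_pos (h : L.Consistent) :
    0 < ∑ W ∈ (Set.toFinite L.worlds).toFinset, L.muHat W := by
  obtain ⟨W, -, hW⟩ := h
  refine lt_of_le_of_ne (Finset.sum_nonneg fun W _ => muHat_nonneg) fun h0 => hW ?_
  -- A quotient by 0 is 0 by convention, so one nonzero `mu W` already excludes a vanishing
  -- denominator.
  rw [mu, ← h0, div_zero]

theorem mu_ne_zero_iff (h : L.Consistent) : L.mu W ≠ 0 ↔ L.muHat W ≠ 0 := by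
  rw [mu, div_ne_zero_iff, and_iff_left h.sum_pos.ne']

theorem hardSM_nonempty (hrule : L.UniqueRule) (hassign : L.UniqueAssignment)
    (h : L.Consistent) : L.plog2lpmln.hardSM.Nonempty := by
  obtain ⟨W, hW, hmu⟩ := id h
  exact ⟨L.extend W, (mem_hardSM_iff_muHat hrule hassign).2
    ⟨hW, rfl, (mu_ne_zero_iff h).1 hmu⟩⟩

theorem isProbStableModel_iff (hrule : L.UniqueRule) (hassign : L.UniqueAssignment)
    (h : L.Consistent) {I : Set L.MAtom} : L.plog2lpmln.IsProbStableModel I ↔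
      restrict I ∈ L.worlds ∧ I = L.extend (restrict I) ∧ L.mu (restrict I) ≠ 0 := by
  rw [LPMLN.isProbStableModel_iff _ (hardSM_nonempty hrule hassign h),
    mem_hardSM_iff_muHat hrule hassign, mu_ne_zero_iff h]

theorem prob_extend (hrule : L.UniqueRule) (hassign : L.UniqueAssignment)
    (h : L.Consistent) (hW : W ∈ L.worlds) (hmu : L.mu W ≠ 0) :
    L.plog2lpmln.prob (L.extend W) = L.mu W := by
  have hmu' := (mu_ne_zero_iff h).1 hmu
  have hmem : L.extend W ∈ L.plog2lpmln.hardSM :=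
    (mem_hardSM_iff_muHat hrule hassign).2 ⟨hW, rfl, hmu'⟩
  rw [LPMLN.prob_eq _ (hardSM_nonempty hrule hassign h), if_pos hmem, sum_hardSM hrule hassign,
    exp_softSum hrule hassign hW ((admissible_iff hrule hassign hW).2 hmu'), mu]

end PLog

end

end PLogMLN

open PLogMLN in
theorem theorem3 (S : Sig.{u, v}) (L : PLog.{u, v, w} S)
    (hrule : L.UniqueRule) (hassign : L.UniqueAssignment) (hcons : L.Consistent) :
    -- the limits that define the probabilities of interpretations exist
    (∀ I : Set L.MAtom,
      Filter.Tendsto (L.plog2lpmln.ratio I) Filter.atTop (nhds (L.plog2lpmln.prob I))) ∧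
    ∃ φ : {W : Set (BaseAtom S) // W ∈ L.worlds ∧ L.mu W ≠ 0} ≃
        {I : Set L.MAtom // L.plog2lpmln.IsProbStableModel I},
      (∀ W, L.mu W.1 = L.plog2lpmln.prob (φ W).1) ∧
      ∀ I, PLog.restrict I.1 ∈ L.worlds ∧ 0 < L.mu (PLog.restrict I.1) ∧
        (φ.symm I).1 = PLog.restrict I.1 := by
  have hiff := fun I => PLog.isProbStableModel_iff hrule hassign hcons (I := I)
  refine ⟨fun I => ?_, ⟨fun W => ⟨L.extend W.1, (hiff _).2 ⟨W.2.1, rfl, W.2.2⟩⟩,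
    fun I => ⟨PLog.restrict I.1, ((hiff _).1 I.2).1, ((hiff _).1 I.2).2.2⟩, fun W => rfl,
    fun I => Subtype.ext ((hiff _).1 I.2).2.1.symm⟩, fun W => ?_, fun I => ?_⟩
  · have hne := PLog.hardSM_nonempty hrule hassign hcons
    rw [LPMLN.prob_eq _ hne]
    exact LPMLN.tendsto_ratio _ hne I
  · exact (PLog.prob_extend hrule hassign hcons W.2.1 W.2.2).symm
  · obtain ⟨hW, -, hmu⟩ := (hiff _).1 I.2
    exact ⟨hW, lt_of_le_of_ne (div_nonneg PLog.muHat_nonneg hcons.sum_pos.le) hmu.symm, rfl⟩
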